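/- **Setting.** Let $\mathcal M=(S,A,\Delta)$ be a finite Markov decision process with partial transition function $\Delta$, in which every state has an available action ($\Delta(s,a)$ is defined), and let $\nu:S\to 2^{AP}$. A run is a sequence $\omega=s_0a_0s_1a_1\dots$ with $\Delta(s_i,a_i)(s_{i+1})>0$, and $\nu(\omega)=\nu(s_0)\nu(s_1)\dots$. A strategy assigns to every finite path ending in a state a distribution over the actions available there; $\mathbb P^{\sigma}_{s}$ is the induced probability measure on runs from $s$. A strategy is deterministic if all its choices are Dirac, and finite-memory if its choice depends only on the state reached by some finite automaton after reading the finite path. Let $\psi$ be a formula of 1-fLTL: it is built from $\mathsf{true}$, $\mathsf{false}$, $\alpha$, $\neg\alpha$ ($\alpha\in AP$), $\wedge,\vee,\mathbf X,\mathbf U,\mathbf G$ and $\mathbf G^1$, where $\omega\models\mathbf G^1\varphi$ iff $\liminf_{k\to\infty}\frac1k\,|\{j<k:\omega(j)\models\varphi\}|\ge 1$, with $\omega(j)$ the suffix $s_ja_js_{j+1}\dots$. Let $\mathbf G^1\varphi_1,\dots,\mathbf G^1\varphi_n$ be the subformulas of $\psi$ of the form $\mathbf G^1\varphi$. For $\xi\in\{\psi,\varphi_1,\dots,\varphi_n\}$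 and $I\subseteq\{1,\dots,n\}$ let $\xi^I$ be the LTL formula obtained from $\xi$ by replacing each outermost subformula $\mathbf G^1\varphi_i$ by $\mathsf{true}$ if $i\in I$ and by $\mathsf{false}$ otherwise, and let $R_{\xi,I}$ be a finite deterministic Rabin automaton over $2^{AP}$ such that $R_{\xi,I}$ accepts $\nu(\omega)$ iff $\omega\models\xi^I$, for all runs $\omega$. (A Rabin automaton has a set of accepting conditions $(E,F)$, where $E,F$ are sets of states, and accepts if for one of them all states of $E$ occur finitely often and some state of $F$ occurs infinitely often.) Let $Q$ be the disjoint union of the state sets of all the $R_{\xi,I}$. For an initial state $s_{in}$, a strategy $\sigma$ and $\lambda>0$, let $\Upsilon_{\lambda}(\sigma,s_{in})$ be the set of pairs $(s,q)$, with $q$ a state of $R_{\psi,I}$ for some $I$, such that there is a finite path $h=h's$ with $\mathbb P^\sigma_{s_{in}}(h)>0$ for which $q$ is the state reached by $R_{\psi,I}$ after reading $\nu(h')$ and $$\mathbb P^\sigma_{s_{in}}\bigl(\{\omega : \omega\models\psi^{I}\ \text{and}\ \{i:\omega\models \mathbf G^1\varphi_i\}=I\}\,\big|\,h\bigr)\ \ge\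 1-\lambda .$$ **The product.** Let $\mathcal C$ be the set of all pairs $(q,x)$ with $q\in Q$ and $x$ one of $\star$, $(E,F)_\circ$, $(E,F)_\bullet$, $\bot$, where $(E,F)$ ranges over the accepting conditions of the automaton of $q$. A set $C\subseteq\mathcal C$ is *fulfilled* if all its elements are of the form $(q,(E,F)_\bullet)$; a state $(s,C)$ is fulfilled if $C$ is. For a fixed $I$, the MDP $\mathcal M_\otimes$ has states $S\times2^{\mathcal C}$ and actions $A\times 2^{\mathcal C}$. Action $(a,C_a)$ is available in $(s,C_s)$ iff $\Delta(s,a)$ is defined and * for every $(q,\star)\in C_s$, $(q,\star)\in C_a$ or $(q,(E,F)_\circ)\in C_a$ for some $(E,F)$; * every $(q,x)\in C_s$ with $x\ne\star$ is in $C_a$; * every other element of $C_a$, i.e. one which is neither an element of $C_s$ nor a pair $(q,(E,F)_\circ)$ with $(q,\star)\in C_s$, is of the form $(q_{in},\star)$ with $q_{in}$ the initial state of $R_{\varphi_i,I}$ for some $i\in I$. Then $\Delta_\otimes((s,C_s),(a,C_a))(t,C_t)=\Delta(s,a)(t)$ if $C_t$ is the set of all $(q',x')$ obtained from the $(q,x)\in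 C_a$ as follows, and it is $0$ for every other $C_t$: $q'$ is the successor of $q$ under $\nu(s)$; $x'=x$ if $x\in\{\star,\bot\}$; and if $x=(E,F)_\circ$ or $x=(E,F)_\bullet$, then $x'=\bot$ if $q'\in E$; $x'=(E,F)_\bullet$ if $q'\in F\setminus E$; and, if $q'\notin E\cup F$, $x'=(E,F)_\circ$ if $C_s$ is fulfilled and $x'=x$ otherwise. **Lemma.** There is $\lambda_0>0$, depending only on $\mathcal M,\nu,\psi$ and the automata, such that the following holds for all $0<\lambda\le\lambda_0$, all initial states $s_{in}$, all strategies $\sigma$ of $\mathcal M$, and all $(s^*,q^*)\in\Upsilon_\lambda(\sigma,s_{in})$. Let $I^*$ be the set such that $q^*$ is a state of $R_{\psi,I^*}$, and let $\mathcal M_\otimes$ be the product for $I=I^*$. Then there are sets $M\subseteq S\times 2^{\mathcal C}$ and $N\subseteq A\times2^{\mathcal C}$ and finite-memory deterministic strategies $\pi,\zeta$ of $\mathcal M_\otimes$ such that 1. for every $(a,C)\in N$ and every $i\in I^*$, $(q_{in},\star)\in C$ for the initial state $q_{in}$ of $R_{\varphi_i,I^*}$; 2. when started in any state of $M$, $\pi$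 never leaves $M$ and only uses actions from $N$; 3. when started in any state of $M\cup\{(s^*,\{(q^*,\star)\})\}$, $\zeta$ almost surely reaches a fulfilled state (possibly leaving $M$) and then reaches $M$; that is, with probability $1$ there are times $i\le j$ such that the $i$-th state of the run is fulfilled and the $j$-th state is in $M$. -/

import Mathlib

open MeasureTheory ProbabilityTheory Filter
open scoped BigOperators

noncomputable section

namespace FreqLTL

universe u v w

/-! ## Markov decision processes -/

/-- A Markov decision process with state set `S` and action set `A` (both assumed finite where
the process is used). The transition function is partial: `trans s a = none` means that it is
undefined at `(s, a)`. Every state has at least one available action. -/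
structure MDP (S : Type u) (A : Type v) where
  trans : S → A → Option (PMF S)
  exists_enabled : ∀ s, ∃ a, (trans s a).isSome

/-- A history `s₀ a₀ s₁ a₁ … sₙ`: the list `[(s₀, a₀), …, (sₙ₋₁, aₙ₋₁)]` and the last state `sₙ`. -/
abbrev Hist (S : Type u) (A : Type v) := List (S × A) × S

/-- Infinite sequences `s₀ a₀ s₁ a₁ …`; the `n`-th entry is the pair `(sₙ, aₙ)`. -/
def Run (S : Type u) (A : Type v) := ℕ → S × A

/-- The σ-algebra on sequences generated by the coordinates (that is, by the cylinders). -/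
instance {S : Type u} {A : Type v} : MeasurableSpace (Run S A) :=
  @MeasurableSpace.pi ℕ (fun _ => S × A) (fun _ => ⊤)

/-- The history `s₀ a₀ … sₙ` that is a prefix of `ω`. -/
def Run.hist {S : Type u} {A : Type v} (ω : Run S A) (n : ℕ) : Hist S A :=
  (List.ofFn (fun i : Fin n => ω i), (ω n).1)

/-- All sequences that have the history `h` as a prefix. -/
def cyl {S : Type u} {A : Type v} (h : Hist S A) : Set (Run S A) :=
  {ω | ω.hist h.1.length = h}

namespace MDP

variable {S : Type u} {A : Type v}

/-- `Δ(s, a)` is defined. -/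
def Enabled (M : MDP S A) (s : S) (a : A) : Prop := (M.trans s a).isSome

/-- The distribution `Δ(s, a)`; the default value is used only where `Δ(s, a)` is undefined,
and no strategy chooses an undefined action. -/
def step (M : MDP S A) (s : S) (a : A) : PMF S := (M.trans s a).getD (PMF.pure s)

/-- `ω` is an infinite path of `M`. -/
def IsRun (M : MDP S A) (ω : Run S A) : Prop :=
  ∀ n, M.Enabled (ω n).1 (ω n).2 ∧ M.step (ω n).1 (ω n).2 (ω (n + 1)).1 ≠ 0

/-- A (history-dependent, randomised) strategy. -/
structure Strategy (M : MDP S A) where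
  act : Hist S A → PMF A
  enabled : ∀ h a, act h a ≠ 0 → M.Enabled h.2 a

variable {M : MDP S A}

/-- The strategy makes a Dirac choice after every history. -/
def Strategy.Deterministic (σ : M.Strategy) : Prop := ∀ h, ∃ a, σ.act h = PMF.pure a

/-- The word `s₀ a₀ s₁ … sₙ` over the disjoint union of states and actions. -/
def histWord (h : Hist S A) : List (S ⊕ A) :=
  h.1.flatMap (fun p => [Sum.inl p.1, Sum.inr p.2]) ++ [Sum.inl h.2]

/-- There is a finite automaton such that the choice of the strategy only depends on the state in
which the automaton ends after reading the history. -/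
def Strategy.FiniteMemory (σ : M.Strategy) : Prop :=
  ∃ (Q : Type) (_ : Finite Q) (q₀ : Q) (upd : Q → S ⊕ A → Q) (choice : Q → PMF A),
    ∀ h, σ.act h = choice ((histWord h).foldl upd q₀)

/-- `ω` is an infinite path all of whose actions are chosen with positive probability by `σ`. -/
def Strategy.Conforms (σ : M.Strategy) (ω : Run S A) : Prop :=
  M.IsRun ω ∧ ∀ n, σ.act (ω.hist n) (ω n).2 ≠ 0

/-- After `(s₀, a₀), …, (sₙ, aₙ)`: draw `sₙ₊₁` from `Δ(sₙ, aₙ)`, then `aₙ₊₁` from the strategy. -/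
def Strategy.next (σ : M.Strategy) (n : ℕ) (x : (i : Finset.Iic n) → S × A) : PMF (S × A) :=
  let past : List (S × A) :=
    List.ofFn (fun i : Fin (n + 1) => x ⟨i, Finset.mem_Iic.2 (Nat.lt_succ_iff.1 i.2)⟩)
  let now : S × A := x ⟨n, Finset.mem_Iic.2 le_rfl⟩
  (M.step now.1 now.2).bind fun t => (σ.act (past, t)).map fun a => (t, a)

/-- The step distributions as Markov kernels (all finite sets are discrete measurable spaces). -/
def Strategy.kernel [Finite S] [Finite A] (σ : M.Strategy) (n : ℕ) :
    @Kernel ((i : Finset.Iic n) → S × A) (S × A) (@MeasurableSpace.pi _ _ (fun _ => ⊤)) ⊤ :=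
  letI : MeasurableSpace (S × A) := ⊤
  haveI : DiscreteMeasurableSpace (S × A) := ⟨fun _ => trivial⟩
  { toFun := fun x => (σ.next n x).toMeasure
    measurable' := measurable_of_countable _ }

/-- The law of `(s₀, a₀)` when the initial state is `s`. -/
def Strategy.start (σ : M.Strategy) (s : S) : PMF ((i : Finset.Iic 0) → S × A) :=
  (σ.act ([], s)).map fun a _ => (s, a)

/-- The probability measure on runs given by a strategy `σ` and an initial state `s`. -/
def Strategy.prob [Finite S] [Finite A] (σ : M.Strategy) (s : S) : Measure (Run S A) :=
  letI : MeasurableSpace (S × A) := ⊤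
  haveI : ∀ n, IsMarkovKernel (σ.kernel n) := fun n =>
    ⟨fun x => PMF.toMeasure.isProbabilityMeasure (σ.next n x)⟩
  (σ.start s).toMeasure.bind (Kernel.traj (X := fun _ => S × A) σ.kernel 0)

end MDP

/-! ## The logic -/

/-- Formulas of 1-fLTL: negations occur only in front of atomic propositions, and the only
frequency operator is the one with bound `1` (here `freq`). As negation is not available for
compound formulas, the constants, conjunction and `G` are primitive; `F φ` is `true U φ`. -/
inductive Formula (AP : Type w) where
  | tt : Formula AP
  | ff : Formula AP
  | atom (α : AP) : Formula AP
  | natom (α : AP) : Formula AP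
  | or (φ χ : Formula AP) : Formula AP
  | and (φ χ : Formula AP) : Formula AP
  | next (φ : Formula AP) : Formula AP
  | untl (φ χ : Formula AP) : Formula AP
  | globally (φ : Formula AP) : Formula AP
  | freq (φ : Formula AP) : Formula AP

/-- The suffix of an infinite word that starts at position `k`. -/
def suffix {X : Type*} (x : ℕ → X) (k : ℕ) : ℕ → X := fun n => x (k + n)

namespace Formula

variable {AP : Type w}

open Classical in
/-- Satisfaction of a formula by an infinite word over `2^AP`. -/
def Sat : Formula AP → (ℕ → Set AP) → Prop
  | tt, _ => True
  | ff, _ => False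
  | atom α, x => α ∈ x 0
  | natom α, x => α ∉ x 0
  | or φ χ, x => φ.Sat x ∨ χ.Sat x
  | and φ χ, x => φ.Sat x ∧ χ.Sat x
  | next φ, x => φ.Sat (suffix x 1)
  | untl φ χ, x => ∃ k, χ.Sat (suffix x k) ∧ ∀ l < k, φ.Sat (suffix x l)
  | globally φ, x => ∀ k, φ.Sat (suffix x k)
  | freq φ, x =>
      1 ≤ liminf (fun n : ℕ =>
        (1 / (n : ℝ)) * ∑ j ∈ Finset.range n, (if φ.Sat (suffix x j) then (1 : ℝ) else 0)) atTop

/-- The set of all `φ` such that `freq φ` is a subformula of the given formula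
(nested ones included). -/
def freqSubs : Formula AP → Set (Formula AP)
  | tt => ∅
  | ff => ∅
  | atom _ => ∅
  | natom _ => ∅
  | or φ χ => φ.freqSubs ∪ χ.freqSubs
  | and φ χ => φ.freqSubs ∪ χ.freqSubs
  | next φ => φ.freqSubs
  | untl φ χ => φ.freqSubs ∪ χ.freqSubs
  | globally φ => φ.freqSubs
  | freq φ => insert φ φ.freqSubs

open Classical in
/-- The LTL formula `ξ^I`: every outermost subformula `freq φ` is replaced by `true` if `φ ∈ I`
and by `false` otherwise. -/
def resolve (I : Set (Formula AP)) : Formula AP → Formula AP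
  | tt => tt
  | ff => ff
  | atom α => atom α
  | natom α => natom α
  | or φ χ => or (φ.resolve I) (χ.resolve I)
  | and φ χ => and (φ.resolve I) (χ.resolve I)
  | next φ => next (φ.resolve I)
  | untl φ χ => untl (φ.resolve I) (χ.resolve I)
  | globally φ => globally (φ.resolve I)
  | freq φ => if φ ∈ I then tt else ff

/-- The set of frequency constraints of `ψ` that hold on the word `x`. -/
def satFreqs (ψ : Formula AP) (x : ℕ → Set AP) : Set (Formula AP) :=
  {φ | φ ∈ ψ.freqSubs ∧ (freq φ).Sat x}

theorem finite_freqSubs (ψ : Formula AP) : ψ.freqSubs.Finite := by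
  induction ψ with
  | tt | ff | atom | natom => exact Set.finite_empty
  | or _ _ h₁ h₂ | and _ _ h₁ h₂ | untl _ _ h₁ h₂ => exact h₁.union h₂
  | next _ h | globally _ h => exact h
  | freq _ h => exact h.insert _

end Formula

/-! ## Rabin automata -/

/-- Deterministic Rabin automata; `acc` is the set of accepting conditions `(E, F)`. -/
structure Rabin (Γ : Type w) where
  State : Type
  finite : Finite State
  init : State
  δ : State → Γ → State
  acc : Set (Set State × Set State)

instance {Γ : Type w} (R : Rabin Γ) : Finite R.State := R.finite

namespace Rabin

variable {Γ : Type w}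

/-- The computation on an infinite word. -/
def comp (R : Rabin Γ) (x : ℕ → Γ) : ℕ → R.State
  | 0 => R.init
  | n + 1 => R.δ (R.comp x n) (x n)

/-- Some `(E, F)` is such that all states of `E` occur only finitely many times and some state of
`F` occurs infinitely many times. -/
def Accepts (R : Rabin Γ) (x : ℕ → Γ) : Prop :=
  ∃ p ∈ R.acc, (∀ q ∈ p.1, {n | R.comp x n = q}.Finite) ∧ ∃ q ∈ p.2, {n | R.comp x n = q}.Infinite

end Rabin

section Automata

variable {S : Type u} {A : Type v} {AP : Type w}

/-- The word `ν(s₀) ν(s₁) …`. -/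
def labels (ν : S → Set AP) (ω : Run S A) : ℕ → Set AP := fun n => ν (ω n).1

/-- Sets of frequency constraints of `ψ`. -/
abbrev Choice (ψ : Formula AP) := {I : Set (Formula AP) // I ⊆ ψ.freqSubs}

/-- Indices `(ξ, I)` of the automata: `ξ` is `ψ` or one of the `φ` with `freq φ` in `ψ`. -/
abbrev AutIdx (ψ : Formula AP) := {ξ : Formula AP // ξ = ψ ∨ ξ ∈ ψ.freqSubs} × Choice ψ

/-- The index of the main automaton for `ψ^I`. -/
def mainIdx {ψ : Formula AP} (I : Choice ψ) : AutIdx ψ := (⟨ψ, Or.inl rfl⟩, I)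

/-- The index of the automaton for `φ^I`, where `freq φ` is a subformula of `ψ`. -/
def subIdx {ψ : Formula AP} (I : Choice ψ) (φ : Formula AP) (h : φ ∈ ψ.freqSubs) : AutIdx ψ :=
  (⟨φ, Or.inr h⟩, I)

/-- For every index `(ξ, I)`, the automaton `R (ξ, I)` is equivalent to `ξ^I`: it accepts the
label word of a run of `M` if and only if the run satisfies `ξ^I`. -/
def Represents (M : MDP S A) (ν : S → Set AP) {ψ : Formula AP}
    (R : AutIdx ψ → Rabin (Set AP)) : Prop :=
  ∀ (k : AutIdx ψ) (ω : Run S A), M.IsRun ω →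
    ((R k).Accepts (labels ν ω) ↔ (k.1.1.resolve k.2.1).Sat (labels ν ω))

/-- The set `Υ` for the strategy `σ`, the initial state `s_in` and the tolerance `lam`: all `(s, q)`
with `q` a state of a main automaton for some `I`, such that there is a history `h = h' s` of
positive probability for which the automaton ends in `q` after reading `ν(h')`, and given `h`, the
run satisfies `ψ^I` and exactly the frequency constraints in `I` with probability at
least `1 - lam`. -/
def Upsilon [Finite S] [Finite A] {M : MDP S A} (ν : S → Set AP) {ψ : Formula AP}
    (R : AutIdx ψ → Rabin (Set AP)) (s_in : S) (σ : M.Strategy) (lam : ℝ) :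
    Set (S × (Σ I : Choice ψ, (R (mainIdx I)).State)) :=
  {x | ∃ h : Hist S A, σ.prob s_in (cyl h) ≠ 0 ∧ h.2 = x.1 ∧
      (h.1.map fun p => ν p.1).foldl (R (mainIdx x.2.1)).δ (R (mainIdx x.2.1)).init = x.2.2 ∧
      1 - lam ≤ (ProbabilityTheory.cond (σ.prob s_in) (cyl h)).real
        {ω | (ψ.resolve x.2.1.1).Sat (labels ν ω) ∧ ψ.satFreqs (labels ν ω) = x.2.1.1}}

/-! ## The product -/

/-- Annotations of automaton states; `P` is the type of accepting conditions. -/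
inductive Tag (P : Type) where
  | star : Tag P
  | circ (p : P) : Tag P
  | bullet (p : P) : Tag P
  | bot : Tag P

instance {P : Type} [Finite P] : Finite (Tag P) := by
  let f : Option (Option (P ⊕ P)) → Tag P
    | none => .star
    | some none => .bot
    | some (some (.inl p)) => .circ p
    | some (some (.inr p)) => .bullet p
  refine Finite.of_surjective f fun t => ?_
  cases t with
  | star => exact ⟨none, rfl⟩
  | bot => exact ⟨some none, rfl⟩
  | circ p => exact ⟨some (some (.inl p)), rfl⟩
  | bullet p => exact ⟨some (some (.inr p)), rfl⟩

variable {ψ : Formula AP}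

/-- The set of all pairs `(q, x)`, for `q` in the disjoint union of the state sets of all automata,
with annotations built from the accepting conditions of the automaton of `q`. -/
abbrev Config (R : AutIdx ψ → Rabin (Set AP)) :=
  Σ k : AutIdx ψ, (R k).State × Tag {p : Set (R k).State × Set (R k).State // p ∈ (R k).acc}

instance : Finite (Choice ψ) := ψ.finite_freqSubs.finite_subsets.to_subtype

instance : Finite {ξ : Formula AP // ξ = ψ ∨ ξ ∈ ψ.freqSubs} :=
  (ψ.finite_freqSubs.insert ψ).to_subtype

instance (R : AutIdx ψ → Rabin (Set AP)) : Finite (Config R) := inferInstance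

variable {R : AutIdx ψ → Rabin (Set AP)}

/-- All elements are of the form `(q, (E, F)_•)`. -/
def Fulfilled (C : Set (Config R)) : Prop := ∀ c ∈ C, ∃ p, c.2.2 = Tag.bullet p

/-- The pairs `(q_in, ☆)` for the initial states of the automata for `φ^I` with `φ ∈ I`. -/
def initConfigs (R : AutIdx ψ → Rabin (Set AP)) (I : Choice ψ) : Set (Config R) :=
  {c | ∃ (φ : Formula AP) (h : φ ∈ I.1),
    c = ⟨subIdx I φ (I.2 h), ((R (subIdx I φ (I.2 h))).init, Tag.star)⟩}

/-- The collection `Ca` may be chosen in a state with collection `Cs`. -/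
structure Legal (I : Choice ψ) (Cs Ca : Set (Config R)) : Prop where
  star : ∀ k q, (⟨k, (q, Tag.star)⟩ : Config R) ∈ Cs →
    (⟨k, (q, Tag.star)⟩ : Config R) ∈ Ca ∨ ∃ p, (⟨k, (q, Tag.circ p)⟩ : Config R) ∈ Ca
  keep : ∀ k q x, x ≠ Tag.star → (⟨k, (q, x)⟩ : Config R) ∈ Cs → (⟨k, (q, x)⟩ : Config R) ∈ Ca
  only : ∀ k q x, (⟨k, (q, x)⟩ : Config R) ∈ Ca →
    (⟨k, (q, x)⟩ : Config R) ∈ Cs ∨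
    ((⟨k, (q, Tag.star)⟩ : Config R) ∈ Cs ∧ ∃ p, x = Tag.circ p) ∨
    (⟨k, (q, x)⟩ : Config R) ∈ initConfigs R I

open Classical in
/-- Annotation after a step to the automaton state `q'` out of a product state with collection
`Cs`. A visit to `E` is a violation, also if the state is in `F`. -/
def evolveTag {Q : Type} {acc : Set (Set Q × Set Q)} (Cs : Set (Config R)) (q' : Q) :
    Tag {p : Set Q × Set Q // p ∈ acc} → Tag {p : Set Q × Set Q // p ∈ acc}
  | .star => .star
  | .bot => .bot
  | .circ p =>
      if q' ∈ p.1.1 then .bot else if q' ∈ p.1.2 then .bullet p else .circ p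
  | .bullet p =>
      if q' ∈ p.1.1 then .bot else if q' ∈ p.1.2 then .bullet p
      else if Fulfilled Cs then .circ p else .bullet p

/-- One pair `(q, x)` evolves by reading the letter `b` into `(q', x')`. -/
def evolveConfig (Cs : Set (Config R)) (b : Set AP) (c : Config R) : Config R :=
  ⟨c.1, ((R c.1).δ c.2.1 b, evolveTag Cs ((R c.1).δ c.2.1 b) c.2.2)⟩

open Classical in
/-- The product of `M` with collections of automaton instances. -/
def product (M : MDP S A) (ν : S → Set AP) (R : AutIdx ψ → Rabin (Set AP)) (I : Choice ψ) :
    MDP (S × Set (Config R)) (A × Set (Config R)) where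
  trans x y :=
    if Legal I x.2 y.2 then
      (M.trans x.1 y.1).map fun d =>
        d.map fun t => (t, evolveConfig x.2 (ν x.1) '' y.2)
    else none
  exists_enabled x := by
    obtain ⟨a, ha⟩ := M.exists_enabled x.1
    have hl : Legal I x.2 x.2 := ⟨fun _ _ h => Or.inl h, fun _ _ _ _ h => h, fun _ _ _ h => Or.inl h⟩
    exact ⟨(a, x.2), by simpa [hl] using ha⟩

end Automata

end FreqLTL

end

/-! Each product state (s, C) gets an objective for the runs of the original process. Exactly the
constraints in I must hold, and every element of C must win: a ☆ state has to accept, a state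
annotated with (E, F) must never enter E again and must visit F infinitely often, and ⊥ has lost.
The state is secure if strategies miss this objective with arbitrarily small probability (`loss`,
`secure`). Since there are only finitely many losses, the nonzero ones are at least some ε > 0
(`exists_gap`). With λ₀ = ε/2 the pair from Υ is therefore secure. More generally, a history given
which an objective fails with probability at most ε/2 certifies loss exactly zero
(`loss_eq_zero_of_cyl`). Optimal strategies are never needed.

The set M of the theorem is a stabilised member of a decreasing sequence: B k contains the states
with loss zero for the objective strengthened by fresh instances that win when started in each of
the next k steps. By finiteness B (K + 1) = B K, and from B (K + 1) some action adding the fresh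
instances leads surely into B K (`exists_closed_set`).

For ζ it is enough to have, from every secure state, one positive-probability path to a fulfilled
state and then to M, along actions that surely preserve security. A rank argument with one bit of
memory turns this into almost sure reachability (`exists_strategy_of_reaches`).

Such paths are found by contradiction. The secure states without a path are closed under safe
actions, and each unsafe action costs a fixed amount of loss, so a near-optimal strategy remains
among them with probability close to one (`exists_mul_prob_stays_compl_le`). It also nearly surely
meets the objective. This is impossible for two reasons: (a) For M: frequency one makes failures of
fresh instances rare, so some window of length K has small total failure probability, and some
history at its start certifies membership in B K (`reaches_of_flag`). (b) For fulfilment: a run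
meeting a Rabin condition avoids E from some time on. One choice of conditions and one time have
positive probability, hence are almost certain after some history, where the ☆ states can be
committed without losing security (`reaches_of_not_fulfilled`). After that, bullets accumulate and
are not reset before all elements carry one (`reaches_of_decided`). -/

namespace FreqLTL

universe u v w

/-! ### Prefix probabilities of trajectory measures. -/

open Preorder in
/-- The probability of a prefix of a trajectory factors through the transition kernel. -/
theorem bind_traj_prefix {X : Type u} [MeasurableSpace X] [MeasurableSingletonClass X]
    (κ : ∀ n, Kernel ((i : Finset.Iic n) → X) X) [∀ n, IsMarkovKernel (κ n)]
    (μ₀ : Measure ((i : Finset.Iic 0) → X)) (n : ℕ) (x : ℕ → X) :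
    (μ₀.bind (Kernel.traj (X := fun _ => X) κ 0)) {ω | ∀ i ≤ n + 1, ω i = x i} =
      (μ₀.bind (Kernel.traj (X := fun _ => X) κ 0)) {ω | ∀ i ≤ n, ω i = x i} *
        κ n (fun i => x i) {x (n + 1)} := by
  set μ : Measure (ℕ → X) := μ₀.bind (Kernel.traj (X := fun _ => X) κ 0) with hμ
  have key : ∀ m, {ω : ℕ → X | ∀ i ≤ m, ω i = x i} =
      frestrictLe (π := fun _ => X) m ⁻¹' {frestrictLe (π := fun _ => X) m x} := by
    intro m
    ext ω
    simp only [Set.mem_ofPred_eq, Set.mem_preimage, Set.mem_singleton_iff, funext_iff,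
      Subtype.forall, Finset.mem_Iic, frestrictLe_apply]
  have hm : ∀ m, μ.map (frestrictLe (π := fun _ => X) m) =
      μ₀.bind (Kernel.partialTraj (X := fun _ => X) κ 0 m) := by
    intro m
    rw [hμ, Measure.map_comp _ _ (by fun_prop), Kernel.traj_map_frestrictLe]
  have h1 : μ.map (frestrictLe (π := fun _ => X) (n + 1)) =
      (μ.map (frestrictLe (π := fun _ => X) n)).bind
        (Kernel.partialTraj (X := fun _ => X) κ n (n + 1)) := by
    rw [hm, hm, Kernel.partialTraj_succ_eq_comp (Nat.zero_le n), Measure.comp_assoc]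
  rw [key, key, ← Measure.map_apply (by fun_prop) (measurableSet_singleton _),
    ← Measure.map_apply (by fun_prop) (measurableSet_singleton _), h1,
    Measure.bind_apply (measurableSet_singleton _) (Kernel.aemeasurable _)]
  -- One step of the trajectory keeps the old prefix and draws the new coordinate from `κ n`, so
  -- only the matching prefix contributes.
  have h2 : ∀ y, Kernel.partialTraj (X := fun _ => X) κ n (n + 1) y
      {frestrictLe (π := fun _ => X) (n + 1) x} =
      Set.indicator {frestrictLe (π := fun _ => X) n x}
        (fun _ => κ n (fun i => x i) {x (n + 1)}) y := by
    intro y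
    have := Kernel.IsMarkovKernel.map (κ n) (MeasurableEquiv.piSingleton (X := fun _ => X) n).measurable
    rw [Kernel.partialTraj_succ_self, Kernel.map_apply _ (measurable_IicProdIoc (X := fun _ => X)),
      Measure.map_apply (measurable_IicProdIoc (X := fun _ => X)) (measurableSet_singleton _)]
    have hS : (IicProdIoc (X := fun _ => X) n (n + 1) ⁻¹'
        {frestrictLe (π := fun _ => X) (n + 1) x}) =
        {frestrictLe (π := fun _ => X) n x} ×ˢ
          (MeasurableEquiv.piSingleton (X := fun _ => X) n '' {x (n + 1)}) := by
      ext ⟨y, z⟩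
      simp only [Set.mem_preimage, Set.mem_singleton_iff, Set.mem_prod, Set.mem_image, funext_iff,
        Subtype.forall, Finset.mem_Iic, frestrictLe_apply, Finset.mem_Ioc, IicProdIoc_def]
      constructor
      · intro h
        refine ⟨fun i hi => by simpa [hi] using h i (by lia), x (n + 1), rfl, fun i hi => ?_⟩
        have := h i hi.2
        rw [dif_neg (by lia)] at this
        obtain rfl : i = n + 1 := by lia
        rw [this]
        rfl
      · rintro ⟨h, w, rfl, h'⟩ i hi
        by_cases hin : i ≤ n
        · rw [dif_pos hin, h i hin]
        · rw [dif_neg hin, ← h' i (by lia)]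
          obtain rfl : i = n + 1 := by lia
          rfl
    rw [hS, Kernel.prod_apply_prod, Kernel.id_apply, Kernel.map_apply _ (MeasurableEquiv.measurable _),
      Measure.map_apply (MeasurableEquiv.measurable (MeasurableEquiv.piSingleton (X := fun _ => X) n))
        ((MeasurableEquiv.piSingleton (X := fun _ => X) n).measurableSet_image.2
          (measurableSet_singleton _)),
      Measure.dirac_apply' _ (measurableSet_singleton _),
      Set.preimage_image_eq _ (MeasurableEquiv.injective _)]
    by_cases hy : y = frestrictLe (π := fun _ => X) n x
    · subst hy; simp; rfl
    · simp [hy]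
  simp_rw [h2]
  rw [lintegral_indicator_const (measurableSet_singleton _), mul_comm]

open Preorder in
theorem bind_traj_zero {X : Type u} [MeasurableSpace X] [MeasurableSingletonClass X]
    (κ : ∀ n, Kernel ((i : Finset.Iic n) → X) X) [∀ n, IsMarkovKernel (κ n)]
    (μ₀ : Measure ((i : Finset.Iic 0) → X)) (x : X) :
    (μ₀.bind (Kernel.traj (X := fun _ => X) κ 0)) {ω | ω 0 = x} = μ₀ {fun _ => x} := by
  have h1 : (μ₀.bind (Kernel.traj (X := fun _ => X) κ 0)).map
      (frestrictLe (π := fun _ => X) 0) = μ₀ := by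
    rw [Measure.map_comp _ _ (by fun_prop), Kernel.traj_map_frestrictLe, Kernel.partialTraj_self,
      Measure.id_comp]
  have h2 : {ω : ℕ → X | ω 0 = x} = frestrictLe (π := fun _ => X) 0 ⁻¹' {fun _ => x} := by
    ext ω
    simp [funext_iff]
  rw [h2, ← Measure.map_apply (by fun_prop) (measurableSet_singleton _), h1]

/-! ### Prefixes and cylinders of runs. -/

section Runs

variable {S : Type u} {A : Type v}

/-- The first `n` entries of `ω`. -/
def Run.pre (ω : Run S A) (n : ℕ) : List (S × A) := List.ofFn fun i : Fin n => ω i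

/-- The suffix of `ω` from time `n` on. -/
def Run.drop (ω : Run S A) (n : ℕ) : Run S A := fun i => ω (n + i)

/-- The sequences that start with the list `l`. -/
def pcyl (l : List (S × A)) : Set (Run S A) := {ω | ω.pre l.length = l}

@[simp] theorem Run.length_pre (ω : Run S A) (n : ℕ) : (ω.pre n).length = n := by simp [Run.pre]

theorem Run.pre_succ (ω : Run S A) (n : ℕ) : ω.pre (n + 1) = ω.pre n ++ [ω n] := by
  rw [Run.pre, List.ofFn_succ_last]; rfl

theorem Run.getElem_pre (ω : Run S A) (n i : ℕ) (h : i < (ω.pre n).length) :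
    (ω.pre n)[i] = ω i :=
  List.getElem_ofFn h

theorem Run.pre_add (ω : Run S A) (n m : ℕ) : ω.pre (n + m) = ω.pre n ++ (ω.drop n).pre m := by
  induction m with
  | zero => simp [Run.pre]
  | succ m ih => rw [← add_assoc, Run.pre_succ, ih, Run.pre_succ, List.append_assoc]; rfl

theorem Run.hist_eq (ω : Run S A) (n : ℕ) : ω.hist n = (ω.pre n, (ω n).1) := rfl

theorem mem_cyl {h : Hist S A} {ω : Run S A} :
    ω ∈ cyl h ↔ ω ∈ pcyl h.1 ∧ (ω h.1.length).1 = h.2 := by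
  simp [cyl, pcyl, Run.hist_eq, Prod.ext_iff]

theorem mem_cyl_hist (ω : Run S A) (n : ℕ) : ω ∈ cyl (ω.hist n) := by
  simp [cyl, Run.hist_eq]

@[simp] theorem pcyl_nil : pcyl ([] : List (S × A)) = Set.univ := by
  ext; simp [pcyl, Run.pre]

theorem mem_pcyl_append {l g : List (S × A)} {ω : Run S A} :
    ω ∈ pcyl (l ++ g) ↔ ω ∈ pcyl l ∧ ω.drop l.length ∈ pcyl g := by
  simp only [pcyl, Set.mem_ofPred_eq, List.length_append, Run.pre_add]
  exact ⟨fun h => List.append_inj h (by simp), fun h => by rw [h.1, h.2]⟩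

theorem mem_pcyl_singleton {p : S × A} {ω : Run S A} : ω ∈ pcyl [p] ↔ ω 0 = p := by
  simp [pcyl, Run.pre]

theorem mem_pcyl_snoc {l : List (S × A)} {p : S × A} {ω : Run S A} :
    ω ∈ pcyl (l ++ [p]) ↔ ω ∈ pcyl l ∧ ω l.length = p := by
  rw [mem_pcyl_append, mem_pcyl_singleton]; rfl

theorem measurableSet_coord (n : ℕ) (P : S × A → Prop) :
    MeasurableSet {ω : Run S A | P (ω n)} :=
  @measurable_pi_apply ℕ (fun _ => S × A) (fun _ => ⊤) n {p | P p} trivial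

theorem measurableSet_pcyl (l : List (S × A)) : MeasurableSet (pcyl l) := by
  induction l using List.reverseRecOn with
  | nil => simp
  | append_singleton l p ih =>
    have : pcyl (l ++ [p]) = pcyl l ∩ {ω | ω l.length = p} := by
      ext; simp [mem_pcyl_snoc]
    rw [this]
    exact ih.inter (measurableSet_coord _ (· = p))

theorem measurableSet_cyl (h : Hist S A) : MeasurableSet (cyl h) := by
  have : cyl h = pcyl h.1 ∩ {ω | (ω h.1.length).1 = h.2} := by
    ext; simp [mem_cyl]
  rw [this]
  exact (measurableSet_pcyl _).inter (measurableSet_coord _ fun p => p.1 = h.2)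

theorem measurable_drop (n : ℕ) : Measurable fun ω : Run S A => ω.drop n := by
  refine @measurable_pi_lambda _ ℕ (fun _ => S × A) _ (fun _ => ⊤) _ fun i => ?_
  exact @measurable_pi_apply ℕ (fun _ => S × A) (fun _ => ⊤) (n + i)

/-- Two finite measures on runs that agree on all prefixes are equal. -/
theorem measure_ext_pcyl [Finite S] [Finite A] {μ ν : Measure (Run S A)} [IsFiniteMeasure μ]
    (h : ∀ l, μ (pcyl l) = ν (pcyl l)) : μ = ν := by
  refine ext_of_generate_finite (insert ∅ (Set.range pcyl)) ?_ ?_ ?_ (by simpa using h [])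
  · apply le_antisymm
    · refine iSup_le fun n => ?_
      rintro _ ⟨B, -, rfl⟩
      -- A condition on one coordinate is a countable union of prefix cylinders, because the
      -- alphabet is finite.
      have : {ω : Run S A | ω n ∈ B} =
          ⋃ l ∈ {l : List (S × A) | ∃ p ∈ B, ∃ l', l'.length = n ∧ l = l' ++ [p]}, pcyl l := by
        ext ω
        simp only [Set.mem_iUnion, Set.mem_ofPred_eq, exists_prop]
        constructor
        · intro hω
          exact ⟨ω.pre n ++ [ω n], ⟨ω n, hω, ω.pre n, by simp, rfl⟩,
            mem_pcyl_snoc.2 ⟨by simp [pcyl], by simp⟩⟩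
        · rintro ⟨_, ⟨p, hp, l', rfl, rfl⟩, hω⟩
          rwa [(mem_pcyl_snoc.1 hω).2]
      change MeasurableSet[MeasurableSpace.generateFrom _] {ω : Run S A | ω n ∈ B}
      rw [this]
      exact @MeasurableSet.biUnion _ _ (MeasurableSpace.generateFrom _) _ _ (Set.to_countable _)
        fun l _ => MeasurableSpace.measurableSet_generateFrom (Or.inr ⟨l, rfl⟩)
    · refine MeasurableSpace.generateFrom_le ?_
      rintro _ (rfl | ⟨l, rfl⟩)
      exacts [MeasurableSet.empty, measurableSet_pcyl l]
  · refine IsPiSystem.insert_empty ?_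
    -- Prefix cylinders that meet are nested, which gives the π-system.
    have key : ∀ l l' : List (S × A), l.length ≤ l'.length → (pcyl l ∩ pcyl l').Nonempty →
        pcyl l ∩ pcyl l' = pcyl l' := by
      rintro l l' hl ⟨ω, h1, h2⟩
      obtain ⟨k, hk⟩ := Nat.exists_eq_add_of_le hl
      have : l' = l ++ (ω.drop l.length).pre k := by
        rw [← h2, hk, Run.pre_add, h1]
      refine Set.inter_eq_self_of_subset_right fun ω' h' => ?_
      rw [this] at h'
      exact (mem_pcyl_append.1 h').1
    rintro _ ⟨l, rfl⟩ _ ⟨l', rfl⟩ hne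
    rcases le_total l.length l'.length with hl | hl
    · exact ⟨l', (key l l' hl hne).symm⟩
    · rw [Set.inter_comm] at hne ⊢
      exact ⟨l, (key l' l hl hne).symm⟩
  · rintro _ (rfl | ⟨l, rfl⟩)
    exacts [by simp, h l]

end Runs

/-! ### Cylinder probabilities and the Markov property. -/

namespace MDP

variable {S : Type u} {A : Type v} {M : MDP S A}

theorem bind_pair_apply (d : PMF S) (f : S → PMF A) (t : S) (b : A) :
    (d.bind fun t => (f t).map fun a => (t, a)) (t, b) = d t * f t b := by
  classical
  rw [PMF.bind_apply, tsum_eq_single t]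
  · congr 1
    rw [PMF.map_apply, tsum_eq_single b]
    · simp
    · intro a ha
      rw [if_neg (by simpa using ha.symm)]
  · intro t' ht'
    rw [PMF.map_apply, ENNReal.tsum_eq_zero.2, mul_zero]
    intro a
    rw [if_neg (by simp [ht'.symm])]

instance [Finite S] [Finite A] (σ : M.Strategy) (s : S) : IsProbabilityMeasure (σ.prob s) := by
  let _ : MeasurableSpace (S × A) := ⊤
  have : ∀ n, IsMarkovKernel (σ.kernel n) := fun n =>
    ⟨fun x => PMF.toMeasure.isProbabilityMeasure (σ.next n x)⟩
  have := PMF.toMeasure.isProbabilityMeasure (σ.start s)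
  unfold Strategy.prob
  exact inferInstanceAs (IsProbabilityMeasure ((σ.start s).toMeasure.bind (Kernel.traj (X := fun _ => S × A) σ.kernel 0)))

theorem prob_pcyl_singleton [Finite S] [Finite A] (σ : M.Strategy) (s t : S) (b : A)
    [Decidable (t = s)] :
    σ.prob s (pcyl [(t, b)]) = (if t = s then 1 else 0) * σ.act ([], t) b := by
  let _ : MeasurableSpace (S × A) := ⊤
  have : DiscreteMeasurableSpace (S × A) := ⟨fun _ => trivial⟩
  have : ∀ n, IsMarkovKernel (σ.kernel n) := fun n =>
    ⟨fun x => PMF.toMeasure.isProbabilityMeasure (σ.next n x)⟩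
  have h1 : σ.prob s {ω | ω 0 = (t, b)} = (σ.start s).toMeasure {fun _ => (t, b)} :=
    bind_traj_zero σ.kernel (σ.start s).toMeasure (t, b)
  have h2 : pcyl [(t, b)] = {ω : Run S A | ω 0 = (t, b)} := by
    ext ω
    exact mem_pcyl_singleton
  rw [h2, h1, PMF.toMeasure_apply_singleton _ _ (measurableSet_singleton _), Strategy.start, PMF.map_apply]
  classical
  rw [tsum_eq_single b]
  · by_cases h : t = s
    · simp [h]
    · rw [if_neg, if_neg h, zero_mul]
      intro h'
      exact h (congrArg Prod.fst (congrFun h' ⟨0, by simp⟩))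
  · intro a ha
    rw [if_neg]
    intro h'
    exact ha (congrArg Prod.snd (congrFun h' ⟨0, by simp⟩)).symm

theorem prob_pcyl_snoc_snoc [Finite S] [Finite A] (σ : M.Strategy) (s : S) (l : List (S × A))
    (q : S × A) (t : S) (b : A) :
    σ.prob s (pcyl (l ++ [q] ++ [(t, b)])) =
      σ.prob s (pcyl (l ++ [q])) * (M.step q.1 q.2 t * σ.act (l ++ [q], t) b) := by
  let _ : MeasurableSpace (S × A) := ⊤
  have : DiscreteMeasurableSpace (S × A) := ⟨fun _ => trivial⟩
  have : ∀ n, IsMarkovKernel (σ.kernel n) := fun n =>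
    ⟨fun x => PMF.toMeasure.isProbabilityMeasure (σ.next n x)⟩
  -- The default value of `getD` is irrelevant: only the first `l.length + 2` entries are read, and
  -- these lie inside the list.
  set x : ℕ → S × A := fun i => (l ++ [q] ++ [(t, b)]).getD i (t, b) with hx
  have h1 : ∀ m ≤ l.length + 1, {ω : Run S A | ∀ i ≤ m, ω i = x i} =
      pcyl ((l ++ [q] ++ [(t, b)]).take (m + 1)) := by
    intro m hm
    ext ω
    have hlen : ((l ++ [q] ++ [(t, b)]).take (m + 1)).length = m + 1 := by
      simp; lia
    simp only [pcyl, Set.mem_ofPred_eq, hlen]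
    rw [List.ext_getElem_iff]
    simp only [hx, Run.length_pre, hlen, true_and]
    refine ⟨fun h i hi hi' => ?_, fun h i hi => ?_⟩
    · have := h i (by lia)
      rw [List.getD_eq_getElem _ _ (by simp; lia)] at this
      simpa [Run.getElem_pre] using this
    · have := h i (by lia) (by lia)
      rw [List.getD_eq_getElem _ _ (by simp; lia)]
      simpa [Run.getElem_pre] using this
  have key := bind_traj_prefix σ.kernel (σ.start s).toMeasure l.length x
  have h2 := h1 (l.length + 1) le_rfl
  have h3 := h1 l.length (by lia)
  rw [List.take_of_length_le (by simp)] at h2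
  rw [List.take_append_of_le_length (by simp), List.take_of_length_le (by simp)] at h3
  have h4 : σ.kernel l.length (fun i => x i) {x (l.length + 1)} =
      M.step q.1 q.2 t * σ.act (l ++ [q], t) b := by
    change (σ.next l.length (fun i => x i)).toMeasure {x (l.length + 1)} = _
    rw [PMF.toMeasure_apply_singleton _ _ (measurableSet_singleton _)]
    have e1 : x (l.length + 1) = (t, b) := by simp [hx]
    have e2 : x l.length = q := by simp [hx]
    have e3 : List.ofFn (fun i : Fin (l.length + 1) => x i) = l ++ [q] := by
      refine List.ext_getElem (by simp) fun i h h' => ?_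
      simp only [List.getElem_ofFn, hx]
      rw [List.getD_eq_getElem _ _ (by simp at h ⊢; lia), List.getElem_append_left]
    rw [e1]
    unfold Strategy.next
    simp only [e2, e3]
    exact bind_pair_apply _ _ _ _
  rw [h4] at key
  change σ.prob s {ω : Run S A | ∀ i ≤ l.length + 1, ω i = x i} =
    σ.prob s {ω : Run S A | ∀ i ≤ l.length, ω i = x i} * _ at key
  rwa [h2, h3] at key

theorem prob_cyl_eq_tsum [Finite S] [Finite A] (σ : M.Strategy) (s : S) (l : List (S × A)) (t : S) :
    σ.prob s (cyl (l, t)) = ∑' b, σ.prob s (pcyl (l ++ [(t, b)])) := by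
  rw [← measure_iUnion]
  · congr 1
    ext ω
    simp only [mem_cyl, Set.mem_iUnion, mem_pcyl_snoc]
    refine ⟨fun h => ⟨(ω l.length).2, h.1, ?_⟩, fun ⟨b, h1, h2⟩ => ⟨h1, by rw [h2]⟩⟩
    rw [← h.2]
  · intro b b' hb
    refine Set.disjoint_left.2 fun ω h h' => hb ?_
    have := (mem_pcyl_snoc.1 h).2.symm.trans (mem_pcyl_snoc.1 h').2
    exact congrArg Prod.snd this
  · exact fun _ => measurableSet_pcyl _

theorem prob_cyl_nil [Finite S] [Finite A] (σ : M.Strategy) (s t : S) [Decidable (t = s)] :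
    σ.prob s (cyl ([], t)) = if t = s then 1 else 0 := by
  simp only [prob_cyl_eq_tsum, List.nil_append, prob_pcyl_singleton, ENNReal.tsum_mul_left,
    PMF.tsum_coe, mul_one]

theorem prob_cyl_snoc [Finite S] [Finite A] (σ : M.Strategy) (s : S) (l : List (S × A))
    (q : S × A) (t : S) :
    σ.prob s (cyl (l ++ [q], t)) = σ.prob s (pcyl (l ++ [q])) * M.step q.1 q.2 t := by
  simp only [prob_cyl_eq_tsum, prob_pcyl_snoc_snoc, ENNReal.tsum_mul_left, PMF.tsum_coe, mul_one]

theorem prob_pcyl_snoc [Finite S] [Finite A] (σ : M.Strategy) (s : S) (l : List (S × A))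
    (u : S) (a : A) :
    σ.prob s (pcyl (l ++ [(u, a)])) = σ.prob s (cyl (l, u)) * σ.act (l, u) a := by
  classical
  rcases List.eq_nil_or_concat l with rfl | ⟨l, q, rfl⟩
  · rw [List.nil_append, prob_pcyl_singleton, prob_cyl_nil]
  · rw [List.concat_eq_append, prob_pcyl_snoc_snoc, prob_cyl_snoc, mul_assoc]

/-- The strategy that behaves after `g` as `σ` does after `h` followed by `g`. -/
def Strategy.after (σ : M.Strategy) (h : List (S × A)) : M.Strategy where
  act g := σ.act (h ++ g.1, g.2)
  enabled g := σ.enabled (h ++ g.1, g.2)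

theorem cyl_eq_inter (h : Hist S A) :
    cyl h = pcyl h.1 ∩ {ω | (ω h.1.length).1 = h.2} := by
  ext ω; exact mem_cyl

/-- After a history, the run is distributed according to the shifted strategy. -/
theorem prob_cyl_inter_drop [Finite S] [Finite A] (σ : M.Strategy) (s : S) (h : Hist S A)
    {Y : Set (Run S A)} (hY : MeasurableSet Y) :
    σ.prob s (cyl h ∩ {ω | ω.drop h.1.length ∈ Y}) =
      σ.prob s (cyl h) * (σ.after h.1).prob h.2 Y := by
  classical
  have key : ((σ.prob s).restrict (cyl h)).map (fun ω => ω.drop h.1.length) =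
      σ.prob s (cyl h) • (σ.after h.1).prob h.2 := by
    refine measure_ext_pcyl fun l => ?_
    rw [Measure.map_apply (measurable_drop _) (measurableSet_pcyl _),
      Measure.restrict_apply (measurable_drop _ (measurableSet_pcyl _)), Measure.smul_apply,
      smul_eq_mul]
    have hF : ∀ g, (fun ω => ω.drop h.1.length) ⁻¹' pcyl g ∩ cyl h =
        pcyl (h.1 ++ g) ∩ {ω | (ω h.1.length).1 = h.2} := by
      intro g
      ext ω
      simp only [Set.mem_inter_iff, Set.mem_preimage, mem_cyl, mem_pcyl_append, Set.mem_ofPred_eq]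
      tauto
    rw [hF]
    -- Both measures satisfy the same recursion in the prefix. The first appended letter is treated
    -- separately, since its state is already fixed by the history.
    induction l using List.reverseRecOn with
    | nil => simp [cyl_eq_inter]
    | append_singleton l p ih =>
      obtain ⟨t, b⟩ := p
      rcases List.eq_nil_or_concat l with rfl | ⟨l, q, rfl⟩
      · rw [List.nil_append, prob_pcyl_singleton]
        by_cases ht : t = h.2
        · have : pcyl (h.1 ++ [(t, b)]) ∩ {ω | (ω h.1.length).1 = h.2} =
              pcyl (h.1 ++ [(t, b)]) := by
            refine Set.inter_eq_self_of_subset_left fun ω hω => ?_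
            rw [Set.mem_ofPred_eq, (mem_pcyl_snoc.1 hω).2, ht]
          rw [this, prob_pcyl_snoc, ht]
          simp [Strategy.after]
        · have : pcyl (h.1 ++ [(t, b)]) ∩ {ω | (ω h.1.length).1 = h.2} = ∅ := by
            refine Set.eq_empty_of_forall_notMem fun ω hω => ht ?_
            rw [← hω.2, (mem_pcyl_snoc.1 hω.1).2]
          simp [this, ht]
      · rw [List.concat_eq_append] at ih ⊢
        rw [prob_pcyl_snoc_snoc, ← mul_assoc, ← ih, ← List.append_assoc, ← List.append_assoc]
        have h0 : ∀ ω ∈ pcyl (h.1 ++ l ++ [q]), ω h.1.length = (l ++ [q])[0]'(by simp) := by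
          intro ω hω
          rw [List.append_assoc] at hω
          have := (mem_pcyl_append.1 hω).2
          have h3 := Run.getElem_pre (ω.drop h.1.length) (l ++ [q]).length 0 (by simp)
          simp only [show (ω.drop h.1.length).pre (l ++ [q]).length = l ++ [q] from this] at h3
          exact h3.symm
        -- The continuation must begin in the last state of the history; otherwise both events are
        -- empty.
        by_cases ht : ((l ++ [q])[0]'(by simp)).1 = h.2
        · rw [Set.inter_eq_self_of_subset_left, Set.inter_eq_self_of_subset_left,
            prob_pcyl_snoc_snoc]
          · simp [Strategy.after]
          · intro ω hω
            rw [Set.mem_ofPred_eq, h0 ω hω, ht]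
          · intro ω hω
            rw [Set.mem_ofPred_eq, h0 ω (mem_pcyl_append.1 hω).1, ht]
        · rw [Set.eq_empty_of_forall_notMem (s := pcyl (h.1 ++ l ++ [q] ++ [(t, b)]) ∩ _),
            Set.eq_empty_of_forall_notMem (s := pcyl (h.1 ++ l ++ [q]) ∩ _)]
          · simp
          · rintro ω ⟨hω, h'⟩
            rw [Set.mem_ofPred_eq, h0 ω hω] at h'
            exact ht h'
          · rintro ω ⟨hω, h'⟩
            rw [Set.mem_ofPred_eq, h0 ω (mem_pcyl_append.1 hω).1] at h'
            exact ht h'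
  have := congrArg (fun m => m Y) key
  simp only [Measure.map_apply (measurable_drop _) hY,
    Measure.restrict_apply (measurable_drop _ hY), Measure.smul_apply, smul_eq_mul] at this
  rw [← this, Set.inter_comm]
  rfl

end MDP
-- Histories given which an event is almost certain.
section Runs

variable {S : Type u} {A : Type v}

/-- The run that starts with `p` and continues with `ω`. -/
def Run.cons (p : S × A) (ω : Run S A) : Run S A
  | 0 => p
  | n + 1 => ω n

theorem Run.cons_drop_one (ω : Run S A) : Run.cons (ω 0) (ω.drop 1) = ω := by
  funext n
  cases n with
  | zero => rfl
  | succ n => exact congrArg ω (add_comm 1 n)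

theorem Run.drop_one_cons (p : S × A) (ω : Run S A) : (Run.cons p ω).drop 1 = ω := by
  funext n
  exact congrArg (Run.cons p ω) (add_comm 1 n)

theorem Run.drop_drop (ω : Run S A) (n m : ℕ) : (ω.drop n).drop m = ω.drop (n + m) := by
  funext i
  exact congrArg ω (add_assoc n m i).symm

@[simp] theorem Run.drop_zero (ω : Run S A) : ω.drop 0 = ω := by
  funext i
  exact congrArg ω (zero_add i)

theorem measurable_cons (p : S × A) : Measurable fun ω : Run S A => Run.cons p ω := by
  refine @measurable_pi_lambda _ ℕ (fun _ => S × A) _ (fun _ => ⊤) _ fun i => ?_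
  cases i with
  | zero => exact measurable_const
  | succ n => exact @measurable_pi_apply ℕ (fun _ => S × A) (fun _ => ⊤) n

theorem cyl_hist_eq {h : Hist S A} {ω : Run S A} (hω : ω ∈ cyl h) : ω.hist h.1.length = h := hω

/-- The measure of a set is the sum over the histories of a given length. -/
theorem measure_eq_tsum_cyl [Finite S] [Finite A] (μ : Measure (Run S A)) (n : ℕ)
    (Y : Set (Run S A)) (hY : MeasurableSet Y) :
    μ Y = ∑' h : {h : Hist S A // h.1.length = n}, μ (cyl h.1 ∩ Y) := by
  rw [← measure_iUnion]
  · congr 1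
    ext ω
    simp only [Set.mem_iUnion, Set.mem_inter_iff, exists_and_right]
    refine ⟨fun h => ⟨⟨⟨ω.hist n, by simp [Run.hist_eq]⟩, mem_cyl_hist ω n⟩, h⟩, fun h => h.2⟩
  · rintro ⟨h, hh⟩ ⟨h', hh'⟩ hne
    refine Set.disjoint_left.2 fun ω h1 h2 => hne ?_
    have e1 := cyl_hist_eq h1.1
    have e2 := cyl_hist_eq h2.1
    simp only [hh, hh'] at e1 e2
    exact Subtype.ext (e1.symm.trans e2)
  · exact fun h => (measurableSet_cyl _).inter hY

/-- If the events `Y` and `D` are almost certain, there is a history of length `n` that is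
compatible with `D` and given which `Y` is almost certain. -/
theorem exists_cyl_of_measure_compl_lt [Finite S] [Finite A] (μ : Measure (Run S A))
    [IsProbabilityMeasure μ] (n : ℕ) {Y D : Set (Run S A)} (hY : MeasurableSet Y)
    (hD : MeasurableSet D) {ε : ENNReal} (hε : ε ≤ 1) (h : μ Yᶜ + μ Dᶜ < ε) :
    ∃ h : Hist S A, h.1.length = n ∧ μ (cyl h ∩ D) ≠ 0 ∧ μ (cyl h ∩ Yᶜ) ≤ ε * μ (cyl h) := by
  by_contra! hcon
  refine absurd h (not_lt.2 ?_)
  -- The weights ε · μ(cyl h) sum to ε. If no history qualifies, each of them is bounded by the mass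
  -- of Yᶜ or, where D has no mass, by that of Dᶜ.
  have h1 : ε = ∑' h : {h : Hist S A // h.1.length = n}, ε * μ (cyl h.1) := by
    rw [ENNReal.tsum_mul_left]
    have := measure_eq_tsum_cyl μ n Set.univ MeasurableSet.univ
    simp only [Set.inter_univ, measure_univ] at this
    rw [← this, mul_one]
  rw [h1, measure_eq_tsum_cyl μ n _ hY.compl, measure_eq_tsum_cyl μ n _ hD.compl,
    ← ENNReal.tsum_add]
  refine ENNReal.tsum_le_tsum fun ⟨h, hh⟩ => ?_
  by_cases h0 : μ (cyl h ∩ D) = 0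
  · calc ε * μ (cyl h) ≤ 1 * μ (cyl h) := by gcongr
      _ = μ (cyl h ∩ D) + μ (cyl h ∩ Dᶜ) := by
        rw [one_mul, ← Set.sdiff_eq, measure_inter_add_sdiff _ hD]
      _ ≤ _ := by rw [h0, zero_add]; exact le_add_self
  · exact (hcon h hh h0).le.trans le_self_add

/-- Sets that are determined by finitely many coordinates. -/
def FinitelyDetermined (t : Set (Run S A)) : Prop :=
  ∃ n, ∀ ω ω' : Run S A, ω.hist n = ω'.hist n → ω ∈ t → ω' ∈ t

/-- A history of length `n` contains the state at time `n` but not the action, so that state has to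
be recovered from the list of pairs when the longer history is strictly longer. -/
theorem hist_eq_of_le {ω ω' : Run S A} {n m : ℕ} (hnm : n ≤ m) (h : ω.hist m = ω'.hist m) :
    ω.hist n = ω'.hist n := by
  obtain ⟨k, rfl⟩ := Nat.exists_eq_add_of_le hnm
  have h1 := congrArg Prod.fst h
  simp only [Run.hist_eq, Run.pre_add] at h1
  refine Prod.ext (List.append_inj h1 (by simp)).1 ?_
  rcases Nat.eq_zero_or_pos k with rfl | hk
  · exact congrArg Prod.snd h
  · have e := congrArg Prod.fst h
    have h2 := Run.getElem_pre ω (n + k) n (by simp [hk])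
    have h3 := Run.getElem_pre ω' (n + k) n (by simp [hk])
    simp only [Run.hist_eq] at e ⊢
    simp only [e] at h2
    rw [← h2, h3]

theorem isSetAlgebra_finitelyDetermined :
    IsSetAlgebra {t : Set (Run S A) | FinitelyDetermined t} where
  empty_mem := ⟨0, fun _ _ _ h => h⟩
  compl_mem := by
    rintro t ⟨n, hn⟩
    exact ⟨n, fun ω ω' h hω hω' => hω (hn ω' ω h.symm hω')⟩
  union_mem := by
    rintro t t' ⟨n, hn⟩ ⟨n', hn'⟩
    refine ⟨max n n', fun ω ω' h hω => hω.imp (hn ω ω' ?_) (hn' ω ω' ?_)⟩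
    exacts [hist_eq_of_le (le_max_left _ _) h, hist_eq_of_le (le_max_right _ _) h]

theorem FinitelyDetermined.measurableSet [Finite S] [Finite A] {t : Set (Run S A)}
    (ht : FinitelyDetermined t) : MeasurableSet t := by
  obtain ⟨n, hn⟩ := ht
  have : t = ⋃ h ∈ {h : Hist S A | ∃ ω ∈ t, h = ω.hist n}, cyl h := by
    ext ω
    simp only [Set.mem_ofPred_eq, Set.mem_iUnion, exists_prop]
    refine ⟨fun h => ⟨_, ⟨ω, h, rfl⟩, mem_cyl_hist ω n⟩, ?_⟩
    rintro ⟨_, ⟨ω', h', rfl⟩, h⟩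
    have := cyl_hist_eq h
    simp only [Run.hist_eq, Run.length_pre] at this
    exact hn _ _ this.symm h'
  rw [this]
  exact MeasurableSet.biUnion (Set.to_countable _) fun h _ => measurableSet_cyl h

theorem generateFrom_finitelyDetermined [Finite S] [Finite A] :
    (inferInstance : MeasurableSpace (Run S A)) =
      MeasurableSpace.generateFrom {t | FinitelyDetermined t} := by
  apply le_antisymm
  · refine iSup_le fun n => ?_
    rintro _ ⟨B, -, rfl⟩
    refine MeasurableSpace.measurableSet_generateFrom ⟨n + 1, fun ω ω' h hω => ?_⟩
    have h1 := congrArg Prod.fst h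
    simp only [Run.hist_eq, Run.pre_succ] at h1
    have h2 : ω n = ω' n := by simpa using (List.append_inj h1 (by simp)).2
    change ω' n ∈ B
    rw [← h2]
    exact hω
  · exact MeasurableSpace.generateFrom_le fun t ht => FinitelyDetermined.measurableSet ht

/-- An event of positive probability is almost certain given some long history (an elementary form
of Lévy's zero-one law). -/
theorem exists_cyl_of_measure_ne_zero [Finite S] [Finite A] (μ : Measure (Run S A))
    [IsFiniteMeasure μ] (n : ℕ) {Z : Set (Run S A)} (hZ : MeasurableSet Z) (h0 : μ Z ≠ 0)
    {ε : ENNReal} (hε : ε ≠ 0) (hε1 : ε ≤ 1) :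
    ∃ h : Hist S A, n ≤ h.1.length ∧ μ (cyl h ∩ Z) ≠ 0 ∧ μ (cyl h ∩ Zᶜ) ≤ ε * μ (cyl h) := by
  have hden : μ.MeasureDense {t | FinitelyDetermined t} :=
    Measure.MeasureDense.of_generateFrom_isSetAlgebra_finite μ isSetAlgebra_finitelyDetermined
      generateFrom_finitelyDetermined
  have hδ : ε * μ Z ≠ 0 := mul_ne_zero hε h0
  have hδ' : ε * μ Z ≠ ⊤ := ENNReal.mul_ne_top (ne_top_of_le_ne_top ENNReal.one_ne_top hε1)
    (measure_ne_top _ _)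
  obtain ⟨t, ⟨N, ht⟩, hlt⟩ := hden.approx Z hZ (measure_ne_top _ _) (ε * μ Z).toReal
    (ENNReal.toReal_pos hδ hδ')
  rw [ENNReal.ofReal_toReal hδ'] at hlt
  by_contra! hcon
  refine absurd hlt (not_lt.2 ?_)
  have htm : MeasurableSet t := FinitelyDetermined.measurableSet ⟨N, ht⟩
  -- At length at least `N` each cylinder lies in `t` or is disjoint from it. It therefore
  -- contributes to the symmetric difference its part outside `Z` or its part inside `Z`, and either
  -- is at least ε · μ(cyl h ∩ Z).
  rw [measure_eq_tsum_cyl μ (max n N) Z hZ, ← ENNReal.tsum_mul_left,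
    measure_eq_tsum_cyl μ (max n N) _ (hZ.symmDiff htm)]
  refine ENNReal.tsum_le_tsum fun ⟨h, hh⟩ => ?_
  by_cases hz : μ (cyl h ∩ Z) = 0
  · rw [hz, mul_zero]
    exact zero_le
  have hc := hcon h (by rw [hh]; exact le_max_left _ _) hz
  by_cases hht : (cyl h ∩ t).Nonempty
  · obtain ⟨ω, hω, hωt⟩ := hht
    have hsub : cyl h ⊆ t := by
      intro ω' hω'
      refine ht ω ω' (hist_eq_of_le (le_max_right n N) ?_) hωt
      rw [← hh, cyl_hist_eq hω, cyl_hist_eq hω']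
    refine le_trans (mul_le_mul_right (measure_mono Set.inter_subset_left) _) (hc.le.trans ?_)
    exact measure_mono fun ω' hω' => ⟨hω'.1, Or.inr ⟨hsub hω'.1, hω'.2⟩⟩
  · refine le_trans (mul_le_mul_left hε1 _) ?_
    rw [one_mul]
    exact measure_mono fun ω' hω' => ⟨hω'.1, Or.inl ⟨hω'.2, fun h' => hht ⟨ω', hω'.1, h'⟩⟩⟩

end Runs

/-- A finite family of extended nonnegative reals is bounded away from zero where it is nonzero. -/
theorem exists_gap {ι : Type*} [Finite ι] (f : ι → ENNReal) :
    ∃ ε : ENNReal, ε ≠ 0 ∧ ε ≤ 1 ∧ ∀ i, f i ≠ 0 → ε ≤ f i := by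
  classical
  have := Fintype.ofFinite ι
  refine ⟨(Finset.univ.filter fun i => f i ≠ 0).inf f ⊓ 1, ?_, inf_le_right, fun i hi => ?_⟩
  · refine (lt_inf_iff.2 ⟨?_, one_pos⟩).ne'
    rw [Finset.lt_inf_iff (by simp)]
    intro i hi
    exact pos_iff_ne_zero.2 (Finset.mem_filter.1 hi).2
  · exact inf_le_left.trans (Finset.inf_le (by simp [hi]))

/-! ### One-step decomposition and the loss of an objective. -/

namespace MDP

variable {S : Type u} {A : Type v} {M : MDP S A}

theorem prob_cyl_singleton [Finite S] [Finite A] (σ : M.Strategy) (s : S) (a : A) (t : S) :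
    σ.prob s (cyl ([(s, a)], t)) = σ.act ([], s) a * M.step s a t := by
  classical
  have := prob_cyl_snoc σ s [] (s, a) t
  rw [List.nil_append] at this
  rw [this, prob_pcyl_singleton]
  simp

theorem ae_fst_zero [Finite S] [Finite A] (σ : M.Strategy) (s : S) :
    ∀ᵐ ω ∂(σ.prob s), (ω 0).1 = s := by
  classical
  have h : σ.prob s (cyl ([], s)) = 1 := by rw [prob_cyl_nil, if_pos rfl]
  rw [← prob_compl_eq_zero_iff (measurableSet_cyl _)] at h
  refine (ae_iff.2 (measure_mono_null (fun ω hω => ?_) h))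
  exact fun h' => hω (mem_cyl.1 h').2

/-- One-step decomposition of the measure on runs. -/
theorem prob_eq_tsum [Finite S] [Finite A] (σ : M.Strategy) (s : S) {Y : Set (Run S A)}
    (hY : MeasurableSet Y) :
    σ.prob s Y = ∑' a, σ.act ([], s) a *
      ∑' t, M.step s a t * (σ.after [(s, a)]).prob t {ω | ω.cons (s, a) ∈ Y} := by
  have h1 : σ.prob s Y = σ.prob s (⋃ x : A × S, cyl ([(s, x.1)], x.2) ∩ Y) := by
    refine measure_congr ?_
    filter_upwards [ae_fst_zero σ s] with ω hω
    refine propext ⟨fun h => Set.mem_iUnion.2 ⟨((ω 0).2, (ω 1).1), ?_, h⟩, fun h => ?_⟩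
    · rw [mem_cyl, mem_pcyl_singleton]
      exact ⟨Prod.ext hω rfl, rfl⟩
    · obtain ⟨x, -, h⟩ := Set.mem_iUnion.1 h
      exact h
  rw [h1, measure_iUnion, ENNReal.tsum_prod (f := fun a t => σ.prob s (cyl ([(s, a)], t) ∩ Y))]
  · congr 1
    funext a
    rw [← ENNReal.tsum_mul_left]
    congr 1
    funext t
    have hm : MeasurableSet {ω : Run S A | ω.cons (s, a) ∈ Y} := measurable_cons _ hY
    have := prob_cyl_inter_drop σ s ([(s, a)], t) hm
    rw [← mul_assoc, ← prob_cyl_singleton, ← this]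
    congr 1
    ext ω
    simp only [Set.mem_inter_iff, Set.mem_ofPred_eq, and_congr_right_iff]
    intro hω
    have h0 := mem_pcyl_singleton.1 (mem_cyl.1 hω).1
    rw [← h0]
    exact iff_of_eq (congrArg (· ∈ Y) ω.cons_drop_one.symm)
  · rintro ⟨a, t⟩ ⟨a', t'⟩ hne
    refine Set.disjoint_left.2 fun ω h h' => hne ?_
    obtain ⟨h1, h2⟩ := mem_cyl.1 h.1
    obtain ⟨h1', h2'⟩ := mem_cyl.1 h'.1
    have := (mem_pcyl_singleton.1 h1).symm.trans (mem_pcyl_singleton.1 h1')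
    exact Prod.ext (congrArg Prod.snd this) (h2.symm.trans h2')
  · exact fun x => (measurableSet_cyl _).inter hY

theorem ae_isRun [Finite S] [Finite A] (σ : M.Strategy) (s : S) :
    ∀ᵐ ω ∂(σ.prob s), M.IsRun ω := by
  unfold IsRun
  rw [ae_all_iff]
  intro n
  have key : ∀ h : Hist S A, ∀ a t, ¬ (M.Enabled h.2 a ∧ M.step h.2 a t ≠ 0) →
      σ.prob s (cyl (h.1 ++ [(h.2, a)], t)) = 0 := by
    intro h a t hn
    rw [prob_cyl_snoc, prob_pcyl_snoc]
    by_cases ha : σ.act (h.1, h.2) a = 0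
    · rw [ha]; simp
    · have : M.step h.2 a t = 0 := by
        by_contra h'
        exact hn ⟨σ.enabled h a ha, h'⟩
      simp [this]
  have h2 : ∀ᵐ ω ∂(σ.prob s), ∀ h : Hist S A, ∀ a t, ¬ (M.Enabled h.2 a ∧ M.step h.2 a t ≠ 0) →
      ω ∉ cyl (h.1 ++ [(h.2, a)], t) := by
    simp only [ae_all_iff]
    exact fun h a t hn => measure_eq_zero_iff_ae_notMem.1 (key h a t hn)
  filter_upwards [h2] with ω hω
  by_contra hn
  refine hω (ω.hist n) (ω n).2 (ω (n + 1)).1 hn ?_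
  rw [mem_cyl, mem_pcyl_snoc]
  simp [Run.hist_eq, pcyl]

/-- The least probability with which a strategy misses the objective `Y` from `s`. -/
noncomputable def loss [Finite S] [Finite A] (M : MDP S A) (s : S) (Y : Set (Run S A)) : ENNReal :=
  ⨅ σ : M.Strategy, σ.prob s Yᶜ

theorem loss_le [Finite S] [Finite A] (σ : M.Strategy) (s : S) (Y : Set (Run S A)) :
    M.loss s Y ≤ σ.prob s Yᶜ := iInf_le _ σ

theorem exists_prob_compl_lt [Finite S] [Finite A] {s : S} {Y : Set (Run S A)}
    (h : M.loss s Y = 0) {ε : ENNReal} (hε : ε ≠ 0) : ∃ σ : M.Strategy, σ.prob s Yᶜ < ε := by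
  by_contra! hcon
  exact hε (le_antisymm (h ▸ le_iInf hcon) zero_le)

theorem exists_step_ne_zero (M : MDP S A) (s : S) (a : A) : ∃ t, M.step s a t ≠ 0 := by
  obtain ⟨t, ht⟩ := (M.step s a).support_nonempty
  exact ⟨t, ht⟩

/-- An objective that can be met with probability arbitrarily close to one admits an action after
which it can still be met so. -/
theorem exists_action_loss_eq_zero [Finite S] [Finite A] {s : S} {Y Y' : Set (Run S A)}
    (hY : MeasurableSet Y) (hYY : ∀ a ω, Run.cons (s, a) ω ∈ Y → ω ∈ Y')
    (h : M.loss s Y = 0) :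
    ∃ a, M.Enabled s a ∧ ∀ t, M.step s a t ≠ 0 → M.loss t Y' = 0 := by
  by_contra! hcon
  -- If every enabled action had a successor of nonzero loss, every choice would cost at least the
  -- least nonzero product κ, uniformly in the strategy.
  obtain ⟨κ, hκ, -, hκ'⟩ := exists_gap fun x : A × S => M.step s x.1 x.2 * M.loss x.2 Y'
  refine hκ (le_antisymm (h ▸ le_iInf fun σ => ?_) zero_le)
  rw [prob_eq_tsum σ s hY.compl]
  calc κ = ∑' a, σ.act ([], s) a * κ := by rw [ENNReal.tsum_mul_right, PMF.tsum_coe, one_mul]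
    _ ≤ _ := by
      refine ENNReal.tsum_le_tsum fun a => ?_
      by_cases ha : σ.act ([], s) a = 0
      · simp [ha]
      obtain ⟨t, ht, ht'⟩ := hcon a (σ.enabled _ _ ha)
      gcongr
      refine (hκ' (a, t) (mul_ne_zero ht ht')).trans (le_trans ?_ (ENNReal.le_tsum t))
      gcongr
      refine (loss_le _ _ _).trans (measure_mono ?_)
      exact fun ω hω h' => hω (hYY a ω h')

/-! ### The price of leaving a set that is closed under safe steps. -/

section Monitor

variable {K : Type*} (next : K → S → K)

/-- The states of a monitor with update function `next` along a run. -/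
def trace (c : K) (ω : Run S A) : ℕ → K
  | 0 => c
  | n + 1 => next (trace c ω n) (ω n).1

theorem trace_cons (c : K) (p : S × A) (ω : Run S A) (n : ℕ) :
    trace next c (Run.cons p ω) (n + 1) = trace next (next c p.1) ω n := by
  induction n with
  | zero => rfl
  | succ n ih =>
    rw [trace, ih]
    rfl

theorem trace_congr (c : K) {ω ω' : Run S A} {n : ℕ} (h : ω.hist n = ω'.hist n) :
    trace next c ω n = trace next c ω' n := by
  induction n with
  | zero => rfl
  | succ n ih =>
    rw [trace, trace, ih (hist_eq_of_le n.le_succ h), show (ω n).1 = (ω' n).1 from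
      congrArg Prod.snd (hist_eq_of_le n.le_succ h)]

/-- The runs that stay in `D` together with the monitor. -/
def stays (D : Set (S × K)) (c : K) : Set (Run S A) :=
  {ω | ∀ n, ((ω n).1, trace next c ω n) ∈ D}

theorem measurableSet_stays [Finite S] [Finite A] (D : Set (S × K)) (c : K) :
    MeasurableSet (stays (A := A) next D c) := by
  have : stays (A := A) next D c = ⋂ n, {ω | ((ω n).1, trace next c ω n) ∈ D} := by
    ext; simp [stays]
  rw [this]
  refine MeasurableSet.iInter fun n => FinitelyDetermined.measurableSet ⟨n, fun ω ω' h hω => ?_⟩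
  rw [Set.mem_ofPred_eq, ← trace_congr next c h, ← show (ω n).1 = (ω' n).1 from
      congrArg Prod.snd h]
  exact hω

/-- Let `D` be closed under those steps that keep the loss at zero. Then the probability to leave
`D` is bounded by a multiple of the probability to miss the objective. -/
theorem exists_mul_prob_stays_compl_le [Finite S] [Finite A] [Finite K] (M : MDP S A)
    (O : K → Set (Run S A)) (hO : ∀ c, MeasurableSet (O c))
    (hcons : ∀ c p ω, Run.cons p ω ∈ O c → ω ∈ O (next c p.1)) :
    ∃ κ : ENNReal, κ ≠ 0 ∧ κ ≤ 1 ∧ ∀ D : Set (S × K),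
      (∀ s c, (s, c) ∈ D → ∀ a, M.Enabled s a →
        (∀ t, M.step s a t ≠ 0 → M.loss t (O (next c s)) = 0) →
        ∀ t, M.step s a t ≠ 0 → (t, next c s) ∈ D) →
      ∀ s c, (s, c) ∈ D → ∀ σ : M.Strategy,
        κ * σ.prob s (stays next D c)ᶜ ≤ σ.prob s (O c)ᶜ := by
  obtain ⟨κ, hκ, hκ1, hκ'⟩ := exists_gap fun x : S × A × S × K =>
    M.step x.1 x.2.1 x.2.2.1 * M.loss x.2.2.1 (O x.2.2.2)
  refine ⟨κ, hκ, hκ1, fun D hD => ?_⟩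
  -- Bounded horizon first, with κ independent of the horizon. A safe action stays in `D`, and the
  -- induction hypothesis applies to the shifted strategy.
  have key : ∀ n, ∀ s c, (s, c) ∈ D → ∀ σ : M.Strategy,
      κ * σ.prob s {ω | ∃ m ≤ n, ((ω m).1, trace next c ω m) ∉ D} ≤ σ.prob s (O c)ᶜ := by
    intro n
    induction n with
    | zero =>
      intro s c hsc σ
      have : σ.prob s {ω | ∃ m ≤ 0, ((ω m).1, trace next c ω m) ∉ D} = 0 := by
        refine measure_eq_zero_iff_ae_notMem.2 ?_
        filter_upwards [ae_fst_zero σ s] with ω hω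
        rintro ⟨m, hm, h'⟩
        obtain rfl : m = 0 := by lia
        rw [hω] at h'
        exact h' hsc
      rw [this, mul_zero]
      exact zero_le
    | succ n ih =>
      intro s c hsc σ
      have hm : MeasurableSet
          {ω : Run S A | ∃ m ≤ n + 1, ((ω m).1, trace next c ω m) ∉ D} := by
        refine FinitelyDetermined.measurableSet ⟨n + 1, ?_⟩
        rintro ω ω' h ⟨m, hm, hω⟩
        refine ⟨m, hm, ?_⟩
        have h' := hist_eq_of_le hm h
        rwa [← trace_congr next c h', ← show (ω m).1 = (ω' m).1 from congrArg Prod.snd h']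
      rw [prob_eq_tsum σ s hm, prob_eq_tsum σ s (hO c).compl, ← ENNReal.tsum_mul_left]
      refine ENNReal.tsum_le_tsum fun a => ?_
      rw [mul_left_comm]
      by_cases ha : σ.act ([], s) a = 0
      · simp [ha]
      gcongr
      by_cases hsafe : ∀ t, M.step s a t ≠ 0 → M.loss t (O (next c s)) = 0
      · rw [← ENNReal.tsum_mul_left]
        refine ENNReal.tsum_le_tsum fun t => ?_
        by_cases ht : M.step s a t = 0
        · simp [ht]
        rw [mul_left_comm]
        gcongr
        refine le_trans ?_ ((ih t (next c s) (hD s c hsc a (σ.enabled _ _ ha) hsafe t ht)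
          (σ.after [(s, a)])).trans ?_)
        · refine mul_le_mul' le_rfl (measure_mono ?_)
          rintro ω ⟨m, hm, h'⟩
          cases m with
          | zero => exact absurd hsc h'
          | succ m =>
            rw [trace_cons] at h'
            exact ⟨m, by lia, h'⟩
        · refine measure_mono ?_
          exact fun ω hω h' => hω (hcons c (s, a) ω h')
      -- An unsafe action alone already misses the objective with probability κ or more, which
      -- outweighs any probability of leaving `D`.
      · push Not at hsafe
        obtain ⟨t, ht, ht'⟩ := hsafe
        calc κ * ∑' t, M.step s a t * _ ≤ κ * ∑' t, M.step s a t * 1 := by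
              gcongr
              exact prob_le_one
          _ = κ := by simp
          _ ≤ M.step s a t * M.loss t (O (next c s)) := hκ' (s, a, t, next c s) (mul_ne_zero ht ht')
          _ ≤ M.step s a t * (σ.after [(s, a)]).prob t {ω | ω.cons (s, a) ∈ (O c)ᶜ} := by
              gcongr
              refine (loss_le _ _ _).trans (measure_mono ?_)
              exact fun ω hω h' => hω (hcons c (s, a) ω h')
          _ ≤ _ := ENNReal.le_tsum t
  intro s c hsc σ
  have hU : (stays next D c)ᶜ = ⋃ n, {ω : Run S A | ∃ m ≤ n, ((ω m).1, trace next c ω m) ∉ D} := by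
    ext ω
    simp only [stays, Set.mem_compl_iff, Set.mem_ofPred_eq, not_forall, Set.mem_iUnion]
    exact ⟨fun ⟨n, hn⟩ => ⟨n, n, le_rfl, hn⟩, fun ⟨n, m, _, hm⟩ => ⟨m, hm⟩⟩
  have hmono : Monotone fun n => {ω : Run S A | ∃ m ≤ n, ((ω m).1, trace next c ω m) ∉ D} :=
    fun n n' hn ω ⟨m, hm, h⟩ => ⟨m, hm.trans hn, h⟩
  rw [hU, hmono.measure_iUnion, ENNReal.mul_iSup]
  exact iSup_le fun n => key n s c hsc σ

end Monitor

end MDP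

/-! ### Finite-memory strategies for reachability and safety. -/

namespace MDP

variable {X : Type u} {Y : Type v} {P : MDP X Y}

open Classical in
/-- Whether the history visits `F`. -/
noncomputable def visits (F : Set X) (h : Hist X Y) : Bool := decide ((∃ p ∈ h.1, p.1 ∈ F) ∨ h.2 ∈ F)

open Classical in
theorem visits_cons (F : Set X) (p : X × Y) (l : List (X × Y)) (x : X) :
    visits F (p :: l, x) = (decide (p.1 ∈ F) || visits F (l, x)) := by
  simp [visits, Bool.decide_or, or_assoc]

open Classical in
theorem visits_nil (F : Set X) (x : X) :
    visits F (([], x) : Hist X Y) = decide (x ∈ F) := by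
  simp [visits]

/-- The deterministic strategy whose choice depends on the current state and on a bit that is set
when the set `F` is visited (or from the beginning if `b` is set). -/
noncomputable def flagStrategy (F : Set X) (act : Bool → X → Y) (hact : ∀ b x, P.Enabled x (act b x)) (b : Bool) :
    P.Strategy where
  act h := PMF.pure (act (b || visits F h) h.2)
  enabled h a ha := by
    rw [PMF.pure_apply] at ha
    have : a = act (b || visits F h) h.2 := by
      by_contra h'
      exact ha (if_neg h')
    rw [this]
    exact hact _ _

variable {F : Set X} {act : Bool → X → Y} {hact : ∀ b x, P.Enabled x (act b x)}

theorem flagStrategy_deterministic (b : Bool) : (flagStrategy F act hact b).Deterministic :=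
  fun _ => ⟨_, rfl⟩

-- The family of flag strategies is closed under shifting: one step only updates the bit. This makes
-- the one-step decomposition a recursion within the family.
open Classical in
theorem flagStrategy_after (b : Bool) (x : X) (y : Y) :
    (flagStrategy F act hact b).after [(x, y)] =
      flagStrategy F act hact (b || decide (x ∈ F)) := by
  simp only [Strategy.after, flagStrategy, List.singleton_append, visits_cons, Bool.or_assoc]

/-- Finite memory, with a memory set in any universe. -/
theorem finiteMemory_of_finite {σ : P.Strategy} {Q : Type w} [Finite Q] (q₀ : Q)
    (upd : Q → X ⊕ Y → Q) (choice : Q → PMF Y)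
    (h : ∀ h, σ.act h = choice ((histWord h).foldl upd q₀)) : σ.FiniteMemory := by
  obtain ⟨n, ⟨e⟩⟩ := Finite.exists_equiv_fin Q
  refine ⟨Fin n, inferInstance, e q₀, fun q z => e (upd (e.symm q) z), fun q => choice (e.symm q),
    fun g => ?_⟩
  have : ∀ (l : List (X ⊕ Y)) q,
      l.foldl (fun q z => e (upd (e.symm q) z)) (e q) = e (l.foldl upd q) := by
    intro l
    induction l with
    | nil => exact fun q => rfl
    | cons z l ih =>
      intro q
      rw [List.foldl_cons, List.foldl_cons, Equiv.symm_apply_apply, ih]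
  rw [h, this]
  exact congrArg choice (e.symm_apply_apply _).symm

-- The memory consists of the bit and the last state read. The initial `x₀` is a dummy, overwritten
-- by the first letter of every history.
open Classical in
theorem flagStrategy_finiteMemory [Finite X] (x₀ : X) (b : Bool) :
    (flagStrategy F act hact b).FiniteMemory := by
  let upd : Bool × X → X ⊕ Y → Bool × X := fun q z =>
    z.elim (fun x => (q.1 || decide (x ∈ F), x)) fun _ => q
  refine finiteMemory_of_finite (b, x₀) upd (fun q => PMF.pure (act q.1 q.2)) ?_
  rintro ⟨l, x⟩
  have : ∀ b x₀, (histWord (l, x)).foldl upd (b, x₀) = (b || visits F (l, x), x) := by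
    induction l with
    | nil =>
      intro b x₀
      simp [histWord, upd, visits_nil]
    | cons p l ih =>
      intro b x₀
      have : histWord (p :: l, x) = Sum.inl p.1 :: Sum.inr p.2 :: histWord (l, x) := by
        simp [histWord]
      rw [this, List.foldl_cons, List.foldl_cons]
      simp only [upd, Sum.elim_inl, Sum.elim_inr] at ih ⊢
      rw [ih, visits_cons, Bool.or_assoc]
  rw [this]
  rfl

/-- `ω` never reaches `T` at or after a visit to `F` (at all, if `b` is set). -/
def misses (F T : Set X) (b : Bool) : Set (Run X Y) :=
  {ω | ∀ i j, i ≤ j → (b = true ∨ (ω i).1 ∈ F) → (ω j).1 ∉ T}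

theorem measurableSet_misses [Finite X] [Finite Y] (F T : Set X) (b : Bool) :
    MeasurableSet (misses (Y := Y) F T b) := by
  have : misses (Y := Y) F T b = ⋂ i, ⋂ j, {ω | i ≤ j → (b = true ∨ (ω i).1 ∈ F) → (ω j).1 ∉ T} := by
    ext; simp [misses]
  rw [this]
  refine MeasurableSet.iInter fun i => MeasurableSet.iInter fun j => ?_
  by_cases hij : i ≤ j
  · have : {ω : Run X Y | i ≤ j → (b = true ∨ (ω i).1 ∈ F) → (ω j).1 ∉ T} =
        {ω | b = true ∨ (ω i).1 ∈ F}ᶜ ∪ {ω | (ω j).1 ∉ T} := by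
      ext ω
      simp only [hij, forall_const, Set.mem_ofPred_eq, Set.mem_union, Set.mem_compl_iff]
      exact imp_iff_not_or
    rw [this]
    exact (measurableSet_coord i fun p => b = true ∨ p.1 ∈ F).compl.union
      (measurableSet_coord j fun p => p.1 ∉ T)
  · simp [hij]

open Classical in
theorem cons_mem_misses {F T : Set X} {b : Bool} {p : X × Y} {ω : Run X Y}
    (h : Run.cons p ω ∈ misses F T b) : ω ∈ misses F T (b || decide (p.1 ∈ F)) := by
  intro i j hij hi
  rcases hi with hi | hi
  · simp only [Bool.or_eq_true, decide_eq_true_eq] at hi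
    exact h 0 (j + 1) (Nat.zero_le _) hi
  · exact h (i + 1) (j + 1) (by lia) (Or.inr hi)

open Classical in
/-- If in a finite process some rank can always decrease until the target is reached, the target is
reached almost surely. -/
theorem flagStrategy_misses_eq_zero [Finite X] [Finite Y] {T : Set X} {W : Bool → X → Prop}
    (rank : Bool → X → ℕ)
    (h : ∀ b x, W b x → (b = true ∧ x ∈ T) ∨
      ((∀ t, P.step x (act b x) t ≠ 0 → W (b || decide (t ∈ F)) t) ∧
        ∃ t, P.step x (act b x) t ≠ 0 ∧ rank (b || decide (t ∈ F)) t < rank b x))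
    (b : Bool) (x : X) (hx : W (b || decide (x ∈ F)) x) :
    (flagStrategy F act hact b).prob x (misses F T b) = 0 := by
  -- In `v` the bit does not yet account for the current state, whereas in `W` and `rank` it does;
  -- hence the recurring `b || decide (x ∈ F)`.
  set v : Bool × X → ENNReal := fun z =>
    (flagStrategy F act hact z.1).prob z.2 (misses F T z.1) with hv
  have hstep : ∀ b x, v (b, x) ≤ ∑' t, P.step x (act (b || decide (x ∈ F)) x) t *
      v (b || decide (x ∈ F), t) := by
    intro b x
    simp only [hv]
    rw [prob_eq_tsum _ x (measurableSet_misses F T b),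
      tsum_eq_single (act (b || decide (x ∈ F)) x)]
    · refine (mul_le_of_le_one_left zero_le (PMF.coe_le_one _ _)).trans ?_
      refine ENNReal.tsum_le_tsum fun t => ?_
      rw [flagStrategy_after]
      exact mul_le_mul' le_rfl (measure_mono fun ω hω => cons_mem_misses hω)
    · intro a ha
      have : (flagStrategy F act hact b).act ([], x) a = 0 := by
        simp only [flagStrategy, visits_nil]
        rw [PMF.pure_apply, if_neg ha]
      rw [this, zero_mul]
  have hgoal : ∀ b x, (b || decide (x ∈ F)) = true → x ∈ T → v (b, x) = 0 := by
    intro b x hb hxT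
    refine (measure_eq_zero_iff_ae_notMem (μ := (flagStrategy F act hact b).prob x)).2 ?_
    filter_upwards [ae_fst_zero (flagStrategy F act hact b) x] with ω hω hm
    refine hm 0 0 le_rfl ?_ (hω ▸ hxT)
    rw [hω]
    simpa using hb
  let Dom : Set (Bool × X) := {z | W (z.1 || decide (z.2 ∈ F)) z.2}
  have hne : Dom.Nonempty := ⟨(b, x), hx⟩
  -- Maximum principle: `v` is bounded by the average over successors, so at a maximiser every
  -- successor is again a maximiser. Following decreasing ranks leads to a target, where `v` is
  -- zero.
  obtain ⟨z₀, hz₀, hmax⟩ := Set.exists_max_image Dom v (Set.toFinite _) hne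
  have hm : v z₀ ≠ ⊤ := measure_ne_top _ _
  have key : ∀ n, ∀ b x, (b, x) ∈ Dom → rank (b || decide (x ∈ F)) x = n → v (b, x) = v z₀ →
      v z₀ = 0 := by
    intro n
    induction n using Nat.strong_induction_on with
    | _ n ih =>
      intro b x hD hr hbx
      rcases h _ _ hD with hg | ⟨hW, t, ht, hlt⟩
      · rw [← hbx]
        exact hgoal b x hg.1 hg.2
      set b' := b || decide (x ∈ F) with hb'
      have hle : ∀ t, P.step x (act b' x) t * v (b', t) ≤ P.step x (act b' x) t * v z₀ := by
        intro t
        by_cases ht : P.step x (act b' x) t = 0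
        · simp [ht]
        · gcongr
          exact hmax (b', t) (hW t ht)
      -- A smaller value at a successor of positive probability would make the average strictly
      -- smaller than the maximum.
      have heq : v (b', t) = v z₀ := by
        refine le_antisymm (hmax (b', t) (hW t ht)) (not_lt.1 fun hvt => ?_)
        have hsum : ∑' t, P.step x (act b' x) t * v z₀ = v z₀ := by
          rw [ENNReal.tsum_mul_right, PMF.tsum_coe, one_mul]
        have h1 : ∑' t, P.step x (act b' x) t * v (b', t) < ∑' t, P.step x (act b' x) t * v z₀ := by
          refine ENNReal.tsum_lt_tsum (ne_top_of_le_ne_top (hsum.trans_ne hm)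
            (ENNReal.tsum_le_tsum hle)) hle (i := t) ?_
          exact ENNReal.mul_lt_mul_right ht (PMF.apply_ne_top _ _) hvt
        rw [hsum, ← hbx] at h1
        exact absurd (hstep b x) (not_le.2 h1)
      exact ih _ (hr ▸ hlt) b' t (hW t ht) rfl heq
  have h0 : v z₀ = 0 := key _ z₀.1 z₀.2 hz₀ rfl rfl
  exact le_antisymm (h0 ▸ hmax (b, x) hx) zero_le

open Classical in
/-- Along actions that surely keep the process in `V`, the set `T` can be reached in `n` steps,
at or after a visit to `F` unless `b` is set. Here `b` already accounts for the current state. -/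
def ReachesIn (P : MDP X Y) (V F T : Set X) : ℕ → Bool → X → Prop
  | 0, b, x => b = true ∧ x ∈ T
  | n + 1, b, x => ∃ y, P.Enabled x y ∧ (∀ t, P.step x y t ≠ 0 → t ∈ V) ∧
      ∃ t, P.step x y t ≠ 0 ∧ ReachesIn P V F T n (b || decide (t ∈ F)) t

/-- The set `T` can be reached along actions that surely keep the process in `V`. -/
def Reaches (P : MDP X Y) (V F T : Set X) (b : Bool) (x : X) : Prop :=
  ∃ n, ReachesIn P V F T n b x

open Classical in
theorem Reaches.step {V F T : Set X} {b : Bool} {x t : X} {y : Y} (hy : P.Enabled x y)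
    (hV : ∀ t, P.step x y t ≠ 0 → t ∈ V) (ht : P.step x y t ≠ 0)
    (h : Reaches P V F T (b || decide (t ∈ F)) t) : Reaches P V F T b x := by
  obtain ⟨n, hn⟩ := h
  exact ⟨n + 1, y, hy, hV, t, ht, hn⟩

open Classical in
/-- If `T` can always be reached safely, some finite-memory strategy reaches it almost surely. -/
theorem exists_strategy_of_reaches [Finite X] [Finite Y] (P : MDP X Y) (x₀ : X) (V F T : Set X)
    (hV : ∀ b, ∀ x ∈ V, Reaches P V F T (b || decide (x ∈ F)) x) :
    ∃ ζ : P.Strategy, ζ.Deterministic ∧ ζ.FiniteMemory ∧ ∀ x ∈ V, ∀ᵐ ω ∂(ζ.prob x),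
      ∃ i j, i ≤ j ∧ (ω i).1 ∈ F ∧ (ω j).1 ∈ T := by
  let rank : Bool → X → ℕ := fun b x => sInf {n | ReachesIn P V F T n b x}
  have hex : ∀ b x, ∃ y, P.Enabled x y ∧ (Reaches P V F T b x → (b = true ∧ x ∈ T) ∨
      ((∀ t, P.step x y t ≠ 0 → t ∈ V) ∧
        ∃ t, P.step x y t ≠ 0 ∧ rank (b || decide (t ∈ F)) t < rank b x)) := by
    intro b x
    by_cases hr : Reaches P V F T b x
    · have hmem : ReachesIn P V F T (rank b x) b x := Nat.sInf_mem hr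
      rcases hn : rank b x with _ | n
      · rw [hn] at hmem
        obtain ⟨y, hy⟩ := P.exists_enabled x
        exact ⟨y, hy, fun _ => Or.inl hmem⟩
      · rw [hn] at hmem
        obtain ⟨y, hy, hyV, t, ht, htn⟩ := hmem
        exact ⟨y, hy, fun _ => Or.inr ⟨hyV, t, ht, Nat.lt_succ_of_le (Nat.sInf_le htn)⟩⟩
    · obtain ⟨y, hy⟩ := P.exists_enabled x
      exact ⟨y, hy, fun h => absurd h hr⟩
  choose act hact hact' using hex
  refine ⟨flagStrategy F act hact false, flagStrategy_deterministic _,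
    flagStrategy_finiteMemory x₀ _, fun x hx => ?_⟩
  -- The invariant `W` says that the bit has been set if the current state lies in `F`; thus
  -- updating it with the current state changes nothing.
  have := flagStrategy_misses_eq_zero (P := P) (F := F) (act := act) (hact := hact) (T := T)
    (W := fun b x => x ∈ V ∧ (x ∈ F → b = true)) rank ?_ false x ⟨hx, by simp⟩
  · filter_upwards [measure_eq_zero_iff_ae_notMem.1 this] with ω hω
    by_contra! hcon
    exact hω fun i j hij hi => hcon i j hij (by simpa using hi)
  · rintro b x ⟨hxV, hxF⟩
    have hb : (b || decide (x ∈ F)) = b := by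
      by_cases h : x ∈ F <;> simp [h, hxF]
    refine (hact' b x (hb ▸ hV b x hxV)).imp id fun ⟨h1, h2⟩ => ⟨fun t ht => ⟨h1 t ht, fun h => ?_⟩, h2⟩
    simp [h]

/-- A memoryless strategy that stays in `T`. -/
theorem exists_strategy_of_closed [Finite X] (P : MDP X Y) (x₀ : X) (T : Set X) (N : Set Y)
    (hT : ∀ x ∈ T, ∃ y ∈ N, P.Enabled x y ∧ ∀ t, P.step x y t ≠ 0 → t ∈ T) :
    ∃ π : P.Strategy, π.Deterministic ∧ π.FiniteMemory ∧ ∀ ω : Run X Y, π.Conforms ω →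
      (ω 0).1 ∈ T → ∀ n, (ω n).1 ∈ T ∧ (ω n).2 ∈ N := by
  have hex : ∀ x, ∃ y, P.Enabled x y ∧
      (x ∈ T → y ∈ N ∧ ∀ t, P.step x y t ≠ 0 → t ∈ T) := by
    intro x
    by_cases hx : x ∈ T
    · obtain ⟨y, h1, h2, h3⟩ := hT x hx
      exact ⟨y, h2, fun _ => ⟨h1, h3⟩⟩
    · obtain ⟨y, hy⟩ := P.exists_enabled x
      exact ⟨y, hy, fun h => absurd h hx⟩
  choose act hact hact' using hex
  refine ⟨flagStrategy ∅ (fun _ => act) (fun _ => hact) false, flagStrategy_deterministic _,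
    flagStrategy_finiteMemory x₀ _, fun ω hω h0 => ?_⟩
  have hchoice : ∀ n, (ω n).2 = act (ω n).1 := by
    intro n
    have := hω.2 n
    simp only [flagStrategy, PMF.pure_apply] at this
    by_contra h'
    exact this (if_neg h')
  have hT' : ∀ n, (ω n).1 ∈ T := by
    intro n
    induction n with
    | zero => exact h0
    | succ n ih =>
      refine (hact' _ ih).2 _ ?_
      rw [← hchoice n]
      exact (hω.1 n).2
  exact fun n => ⟨hT' n, hchoice n ▸ (hact' _ (hT' n)).1⟩

end MDP

/-! ### Asymptotic frequencies -/

open Classical in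
/-- The frequency of `P` among the first `n` natural numbers. -/
noncomputable def frequency (P : ℕ → Prop) (n : ℕ) : ℝ :=
  (1 / (n : ℝ)) * ∑ j ∈ Finset.range n, (if P j then (1 : ℝ) else 0)

theorem frequency_nonneg (P : ℕ → Prop) (n : ℕ) : 0 ≤ frequency P n := by
  unfold frequency
  refine mul_nonneg (by positivity) (Finset.sum_nonneg fun j _ => ?_)
  split_ifs <;> norm_num

theorem frequency_le_one (P : ℕ → Prop) (n : ℕ) : frequency P n ≤ 1 := by
  classical
  have h : ∑ j ∈ Finset.range n, (if P j then (1 : ℝ) else 0) ≤ n := by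
    refine (Finset.sum_le_card_nsmul _ _ 1 fun j _ => ?_).trans (by simp)
    split_ifs <;> norm_num
  calc frequency P n ≤ (1 / (n : ℝ)) * n := by
        unfold frequency
        gcongr
    _ ≤ 1 := by
        rw [one_div]
        exact inv_mul_le_one

theorem frequency_mono {P Q : ℕ → Prop} (h : ∀ j, P j → Q j) (n : ℕ) :
    frequency P n ≤ frequency Q n := by
  unfold frequency
  gcongr with j _
  by_cases hP : P j
  · simp [hP, h j hP]
  · rw [if_neg hP]
    split_ifs <;> norm_num

theorem frequency_add_frequency_not (P : ℕ → Prop) {n : ℕ} (hn : n ≠ 0) :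
    frequency P n + frequency (fun j => ¬ P j) n = 1 := by
  classical
  unfold frequency
  rw [← mul_add, ← Finset.sum_add_distrib]
  rw [Finset.sum_congr rfl (g := fun _ => (1 : ℝ))]
  · simp [hn]
  · intro j _
    by_cases h : P j <;> simp [h]

/-- The lower frequency is one if and only if the exceptions have frequency zero. -/
theorem one_le_liminf_frequency_iff (P : ℕ → Prop) :
    1 ≤ liminf (frequency P) atTop ↔ Tendsto (frequency fun j => ¬ P j) atTop (nhds 0) := by
  have hb : IsBoundedUnder (· ≤ ·) atTop (frequency P) :=
    isBoundedUnder_of ⟨1, frequency_le_one P⟩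
  have hb' : IsBoundedUnder (· ≥ ·) atTop (frequency P) :=
    isBoundedUnder_of ⟨0, frequency_nonneg P⟩
  have key : Tendsto (frequency P) atTop (nhds 1) ↔
      Tendsto (frequency fun j => ¬ P j) atTop (nhds 0) := by
    have h1 : (fun n => 1 - frequency P n) =ᶠ[atTop] frequency fun j => ¬ P j := by
      filter_upwards [eventually_ne_atTop 0] with n hn
      rw [← frequency_add_frequency_not P hn]
      ring
    rw [← tendsto_congr' h1]
    constructor
    · intro h
      simpa using h.const_sub 1
    · intro h
      simpa using h.const_sub 1
  rw [← key]
  refine ⟨fun h => tendsto_of_le_liminf_of_limsup_le h ?_ hb hb', fun h => h.liminf_eq.ge⟩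
  exact limsup_le_of_le (hb'.isCoboundedUnder_le) (Eventually.of_forall (frequency_le_one P))

/-- Deleting one term changes a sum by at most one, which vanishes after averaging. Vanishing
frequency is thus a property of the tail. -/
theorem tendsto_frequency_succ_iff (P : ℕ → Prop) :
    Tendsto (frequency fun j => P (1 + j)) atTop (nhds 0) ↔
      Tendsto (frequency P) atTop (nhds 0) := by
  classical
  have hsum : ∀ n, ∑ j ∈ Finset.range (n + 1), (if P j then (1 : ℝ) else 0) =
      ∑ j ∈ Finset.range n, (if P (1 + j) then (1 : ℝ) else 0) + if P 0 then 1 else 0 := by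
    intro n
    rw [Finset.sum_range_succ']
    simp only [add_comm 1]
  have h0 : (0 : ℝ) ≤ if P 0 then 1 else 0 := by split_ifs <;> norm_num
  have h0' : (if P 0 then (1 : ℝ) else 0) ≤ 1 := by split_ifs <;> norm_num
  have hnn : ∀ n, 0 ≤ ∑ j ∈ Finset.range n, (if P (1 + j) then (1 : ℝ) else 0) := fun n =>
    Finset.sum_nonneg fun j _ => by split_ifs <;> norm_num
  rw [← tendsto_add_atTop_iff_nat (f := frequency P) 1]
  constructor
  · intro h
    have h1 : Tendsto (fun n : ℕ => (frequency fun j => P (1 + j)) n + 1 / ((n : ℝ) + 1)) atTop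
        (nhds 0) := by
      simpa using h.add (tendsto_one_div_add_atTop_nhds_zero_nat (𝕜 := ℝ))
    refine squeeze_zero' (Eventually.of_forall fun n => frequency_nonneg P _) ?_ h1
    filter_upwards [eventually_gt_atTop 0] with n hn
    have hn' : (0 : ℝ) < n := by exact_mod_cast hn
    unfold frequency
    rw [hsum, mul_add]
    push_cast
    refine add_le_add ?_ ?_
    · refine mul_le_mul_of_nonneg_right ?_ (hnn n)
      exact one_div_le_one_div_of_le hn' (by linarith)
    · refine (mul_le_mul_of_nonneg_left h0' (by positivity)).trans (by simp)
  · intro h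
    have h1 : Tendsto (fun n : ℕ => 2 * frequency P (n + 1)) atTop (nhds 0) := by
      simpa using h.const_mul 2
    refine squeeze_zero' (Eventually.of_forall fun n => frequency_nonneg _ _) ?_ h1
    filter_upwards [eventually_gt_atTop 0] with n hn
    have hn' : (1 : ℝ) ≤ n := by exact_mod_cast hn
    unfold frequency
    rw [hsum, ← mul_assoc]
    push_cast
    refine mul_le_mul ?_ (le_add_of_nonneg_right h0) (hnn n) (by positivity)
    -- The comparison 1/n ≤ 2/(n + 1), valid for n ≥ 1, accounts for the factor two.
    rw [mul_one_div, div_le_div_iff₀ (by linarith) (by linarith)]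
    linarith

theorem tendsto_frequency_exists {ι : Type*} [Finite ι] {P : ι → ℕ → Prop}
    (h : ∀ i, Tendsto (frequency (P i)) atTop (nhds 0)) :
    Tendsto (frequency fun j => ∃ i, P i j) atTop (nhds 0) := by
  classical
  have := Fintype.ofFinite ι
  have h1 : Tendsto (fun n => ∑ i, frequency (P i) n) atTop (nhds 0) := by
    simpa using tendsto_finsetSum Finset.univ fun i _ => h i
  refine squeeze_zero (fun n => frequency_nonneg _ _) (fun n => ?_) h1
  unfold frequency
  rw [← Finset.mul_sum, Finset.sum_comm]
  gcongr with j _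
  have hnn : ∀ i, (0 : ℝ) ≤ if P i j then 1 else 0 := fun i => by split_ifs <;> norm_num
  by_cases hex : ∃ i, P i j
  · obtain ⟨i, hi⟩ := hex
    rw [if_pos ⟨i, hi⟩]
    refine le_trans ?_ (Finset.single_le_sum (fun i _ => hnn i) (Finset.mem_univ i))
    rw [if_pos hi]
  · rw [if_neg hex]
    exact Finset.sum_nonneg fun i _ => hnn i

/-- A nonnegative sequence whose averages vanish has windows of any length with small sum. -/
theorem exists_window_sum_lt {f : ℕ → ℝ}
    (h : Tendsto (fun n : ℕ => (1 / (n : ℝ)) * ∑ j ∈ Finset.range n, f j) atTop (nhds 0))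
    (K : ℕ) {δ : ℝ} (hδ : 0 < δ) : ∃ n, ∑ i ∈ Finset.range K, f (n + i) < δ := by
  by_contra! hcon
  rcases Nat.eq_zero_or_pos K with rfl | hK
  · simpa using (hcon 0).trans_lt' hδ
  -- If each of the consecutive windows of length `K` contributes δ, the averages at multiples of
  -- `K` stay at least δ / K.
  have hsum : ∀ m : ℕ, m * δ ≤ ∑ j ∈ Finset.range (m * K), f j := by
    intro m
    induction m with
    | zero => simp
    | succ m ih =>
      rw [Nat.succ_mul, Finset.sum_range_add]
      push_cast
      linarith [hcon (m * K)]
  have hK' : (0 : ℝ) < K := by exact_mod_cast hK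
  have h1 : ∀ᶠ n : ℕ in atTop, (1 / (n : ℝ)) * ∑ j ∈ Finset.range n, f j < δ / K :=
    h.eventually_lt_const (by positivity)
  obtain ⟨N, hN⟩ := eventually_atTop.1 h1
  have h2 := hN ((N + 1) * K) (by nlinarith)
  have h3 := hsum (N + 1)
  rw [lt_div_iff₀ hK', one_div, inv_mul_eq_div, div_mul_eq_mul_div, div_lt_iff₀ (by positivity)]
    at h2
  push_cast at h2 h3
  nlinarith

/-- Events that almost surely have frequency zero have windows of small total probability. -/
theorem exists_window_measure_lt {Ω : Type*} [MeasurableSpace Ω] (μ : Measure Ω)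
    [IsFiniteMeasure μ] {Q : ℕ → Set Ω} (hQ : ∀ j, MeasurableSet (Q j))
    (h : ∀ᵐ ω ∂μ, Tendsto (frequency fun j => ω ∈ Q j) atTop (nhds 0)) (K : ℕ) {δ : ENNReal}
    (hδ : δ ≠ 0) : ∃ n, ∑ i ∈ Finset.range K, μ (Q (n + i)) < δ := by
  classical
  have hind : ∀ j, (fun ω => if ω ∈ Q j then (1 : ℝ) else 0) = (Q j).indicator fun _ => 1 := by
    intro j
    funext ω
    simp [Set.indicator_apply]
  have hint : ∀ j, Integrable (fun ω => if ω ∈ Q j then (1 : ℝ) else 0) μ := by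
    intro j
    rw [hind]
    exact (integrable_const 1).indicator (hQ j)
  -- Dominated convergence, with bound one, passes from almost sure frequency zero to vanishing
  -- averages of the probabilities.
  have h1 : Tendsto (fun n => ∫ ω, frequency (fun j => ω ∈ Q j) n ∂μ) atTop
      (nhds (∫ _, (0 : ℝ) ∂μ)) := by
    refine tendsto_integral_of_dominated_convergence (fun _ => 1) (fun n => ?_)
      (integrable_const 1) (fun n => Eventually.of_forall fun ω => ?_) h
    · unfold frequency
      have := ((integrable_finsetSum (Finset.range n) fun j _ => hint j).const_mul
        (1 / (n : ℝ))).aestronglyMeasurable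
      convert this using 5
    · rw [Real.norm_of_nonneg (frequency_nonneg _ _)]
      exact frequency_le_one _ _
  have h2 : ∀ n, ∫ ω, frequency (fun j => ω ∈ Q j) n ∂μ =
      (1 / (n : ℝ)) * ∑ j ∈ Finset.range n, μ.real (Q j) := by
    intro n
    have : ∀ j, ∫ ω, (if ω ∈ Q j then (1 : ℝ) else 0) ∂μ = μ.real (Q j) := by
      intro j
      rw [hind, integral_indicator_const _ (hQ j)]
      simp
    rw [← Finset.sum_congr rfl fun j _ => this j, ← integral_finsetSum _ fun j _ => hint j,
      ← integral_const_mul]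
    unfold frequency
    congr! 6
  simp only [h2, integral_zero] at h1
  rcases eq_or_ne δ ⊤ with rfl | hδ'
  · exact ⟨0, ENNReal.sum_lt_top.2 fun i _ => measure_lt_top _ _⟩
  obtain ⟨n, hn⟩ := exists_window_sum_lt h1 K (ENNReal.toReal_pos hδ hδ')
  refine ⟨n, ?_⟩
  rw [← ENNReal.toReal_lt_toReal (ENNReal.sum_lt_top.2 fun i _ => measure_lt_top _ _).ne hδ',
    ENNReal.toReal_sum fun i _ => measure_ne_top _ _]
  exact hn

/-! ### Formulas -/

theorem suffix_suffix {Γ : Type*} (x : ℕ → Γ) (k l : ℕ) :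
    suffix (suffix x k) l = suffix x (k + l) := by
  funext n
  exact congrArg x (add_assoc k l n).symm

namespace Formula

variable {AP : Type w}

theorem freq_sat_iff (φ : Formula AP) (x : ℕ → Set AP) :
    (freq φ).Sat x ↔ Tendsto (frequency fun j => ¬ φ.Sat (suffix x j)) atTop (nhds 0) :=
  one_le_liminf_frequency_iff fun j => φ.Sat (suffix x j)

/-- Since frequency constraints depend only on the tail, one set `I` describes all suffixes of a
run, and a resolution by `I` remains correct under every temporal operator. -/
theorem freq_sat_suffix (φ : Formula AP) (x : ℕ → Set AP) (k : ℕ) :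
    (freq φ).Sat (suffix x k) ↔ (freq φ).Sat x := by
  induction k with
  | zero =>
    have : suffix x 0 = x := by
      funext n
      exact congrArg x (zero_add n)
    rw [this]
  | succ k ih =>
    rw [← ih, ← suffix_suffix, freq_sat_iff, freq_sat_iff,
      ← tendsto_frequency_succ_iff fun j => ¬ φ.Sat (suffix (suffix x k) j)]
    simp only [suffix_suffix, add_assoc]

theorem satFreqs_suffix (ψ : Formula AP) (x : ℕ → Set AP) (k : ℕ) :
    ψ.satFreqs (suffix x k) = ψ.satFreqs x := by
  ext φ
  simp only [satFreqs, Set.mem_ofPred_eq, freq_sat_suffix]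

theorem freqSubs_subset {φ ψ : Formula AP} (h : φ ∈ ψ.freqSubs) : φ.freqSubs ⊆ ψ.freqSubs := by
  induction ψ with
  | tt | ff | atom | natom => exact absurd h (Set.notMem_empty _)
  | or _ _ h₁ h₂ | and _ _ h₁ h₂ | untl _ _ h₁ h₂ =>
    rcases h with h | h
    · exact (h₁ h).trans Set.subset_union_left
    · exact (h₂ h).trans Set.subset_union_right
  | next _ ih | globally _ ih => exact ih h
  | freq χ ih =>
    rcases h with rfl | h
    · exact Set.subset_insert _ _
    · exact (ih h).trans (Set.subset_insert _ _)

/-- Where exactly the frequency constraints in `I` hold, resolving them according to `I` does not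
change satisfaction. -/
theorem sat_resolve_iff {ψ : Formula AP} {I : Set (Formula AP)} (φ : Formula AP)
    (hφ : φ.freqSubs ⊆ ψ.freqSubs) (x : ℕ → Set AP) (hx : ψ.satFreqs x = I) :
    (φ.resolve I).Sat x ↔ φ.Sat x := by
  induction φ generalizing x with
  | tt | ff | atom | natom => exact Iff.rfl
  | or φ χ h₁ h₂ =>
    exact or_congr (h₁ (Set.subset_union_left.trans hφ) x hx)
      (h₂ (Set.subset_union_right.trans hφ) x hx)
  | and φ χ h₁ h₂ =>
    exact and_congr (h₁ (Set.subset_union_left.trans hφ) x hx)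
      (h₂ (Set.subset_union_right.trans hφ) x hx)
  | next φ ih => exact ih hφ _ ((satFreqs_suffix ψ x 1).trans hx)
  | untl φ χ h₁ h₂ =>
    refine exists_congr fun k => and_congr ?_ (forall_congr' fun l => imp_congr Iff.rfl ?_)
    · exact h₂ (Set.subset_union_right.trans hφ) _ ((satFreqs_suffix ψ x k).trans hx)
    · exact h₁ (Set.subset_union_left.trans hφ) _ ((satFreqs_suffix ψ x l).trans hx)
  | globally φ ih => exact forall_congr' fun k => ih hφ _ ((satFreqs_suffix ψ x k).trans hx)
  | freq φ _ =>
    have hmem : φ ∈ I ↔ (freq φ).Sat x := by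
      rw [← hx]
      exact ⟨fun h => h.2, fun h => ⟨hφ (Set.mem_insert _ _), h⟩⟩
    rw [← hmem, resolve]
    by_cases h : φ ∈ I
    · rw [if_pos h]
      exact iff_of_true trivial h
    · rw [if_neg h]
      exact iff_of_false id h

theorem measurableSet_sat {S : Type u} {A : Type v} (ν : S → Set AP) (φ : Formula AP) :
    MeasurableSet {ω : Run S A | φ.Sat (labels ν ω)} := by
  have hdrop : ∀ {χ : Formula AP}, MeasurableSet {ω : Run S A | χ.Sat (labels ν ω)} → ∀ k,
      MeasurableSet {ω : Run S A | χ.Sat (suffix (labels ν ω) k)} :=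
    fun h k => measurable_drop k h
  induction φ with
  | tt => exact MeasurableSet.univ
  | ff => exact MeasurableSet.empty
  | atom α => exact measurableSet_coord 0 fun p => α ∈ ν p.1
  | natom α => exact measurableSet_coord 0 fun p => α ∉ ν p.1
  | or φ χ h₁ h₂ => exact h₁.union h₂
  | and φ χ h₁ h₂ => exact h₁.inter h₂
  | next φ ih => exact hdrop ih 1
  | untl φ χ h₁ h₂ =>
    have : {ω : Run S A | (untl φ χ).Sat (labels ν ω)} =
        ⋃ k, {ω | χ.Sat (suffix (labels ν ω) k)} ∩
          ⋂ l, ⋂ (_ : l < k), {ω | φ.Sat (suffix (labels ν ω) l)} := by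
      ext ω
      simp [Sat]
    rw [this]
    exact MeasurableSet.iUnion fun k => (hdrop h₂ k).inter
      (MeasurableSet.iInter fun l => MeasurableSet.iInter fun _ => hdrop h₁ l)
  | globally φ ih =>
    have : {ω : Run S A | (globally φ).Sat (labels ν ω)} =
        ⋂ k, {ω | φ.Sat (suffix (labels ν ω) k)} := by
      ext ω
      simp [Sat]
    rw [this]
    exact MeasurableSet.iInter fun k => hdrop ih k
  | freq φ ih =>
    refine measurableSet_le measurable_const (Measurable.liminf fun n => ?_)
    refine (Finset.measurable_fun_sum _ fun j _ => ?_).const_mul _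
    exact Measurable.ite (hdrop ih j) measurable_const measurable_const

end Formula

/-! ### Automata -/

namespace Rabin

variable {Γ : Type w} (R : Rabin Γ)

/-- The computation from the state `q`. -/
def compFrom (q : R.State) (x : ℕ → Γ) : ℕ → R.State
  | 0 => q
  | n + 1 => R.δ (compFrom q x n) (x n)

theorem compFrom_init (x : ℕ → Γ) (n : ℕ) : R.compFrom R.init x n = R.comp x n := by
  induction n with
  | zero => rfl
  | succ n ih => rw [compFrom, ih, comp]

theorem compFrom_add (q : R.State) (x : ℕ → Γ) (n m : ℕ) :
    R.compFrom q x (n + m) = R.compFrom (R.compFrom q x n) (suffix x n) m := by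
  induction m with
  | zero => rfl
  | succ m ih => rw [← add_assoc, compFrom, ih]; rfl

theorem compFrom_succ (q : R.State) (x : ℕ → Γ) (n : ℕ) :
    R.compFrom q x (n + 1) = R.compFrom (R.δ q (x 0)) (suffix x 1) n := by
  rw [add_comm, compFrom_add]
  rfl

theorem foldl_ofFn (q : R.State) (x : ℕ → Γ) (n : ℕ) :
    (List.ofFn fun i : Fin n => x i).foldl R.δ q = R.compFrom q x n := by
  induction n with
  | zero => simp [compFrom]
  | succ n ih =>
    rw [List.ofFn_succ_last, List.foldl_append]
    change R.δ ((List.ofFn fun i : Fin n => x i).foldl R.δ q) (x n) = _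
    rw [ih]
    rfl

/-- Acceptance of the condition `p` in the long run. -/
def Meets (q : R.State) (x : ℕ → Γ) (p : Set R.State × Set R.State) : Prop :=
  (∀ᶠ n in atTop, R.compFrom q x n ∉ p.1) ∧ ∃ᶠ n in atTop, R.compFrom q x n ∈ p.2

/-- With finitely many states, a set is visited infinitely often exactly when one of its members is,
and finitely often exactly when all of them are. -/
theorem accepts_iff (x : ℕ → Γ) : R.Accepts x ↔ ∃ p ∈ R.acc, R.Meets R.init x p := by
  unfold Accepts Meets
  refine exists_congr fun p => and_congr_right fun _ => and_congr ?_ ?_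
  · have h : (∀ᶠ n in atTop, R.compFrom R.init x n ∉ p.1) ↔
        ∀ᶠ n in atTop, ∀ q ∈ p.1, R.comp x n ≠ q := by
      refine eventually_congr (Eventually.of_forall fun n => ?_)
      rw [compFrom_init]
      exact ⟨fun h q hq hn => h (hn ▸ hq), fun h hn => h _ hn rfl⟩
    rw [h, eventually_all_finite (Set.toFinite p.1)]
    refine forall₂_congr fun q _ => ?_
    rw [← Nat.cofinite_eq_atTop, eventually_cofinite]
    simp
  · simp only [compFrom_init, Nat.frequently_atTop_iff_infinite]
    constructor
    · rintro ⟨q, hq, h⟩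
      exact h.mono fun n hn => by rw [Set.mem_ofPred_eq] at hn ⊢; rwa [hn]
    · intro h
      by_contra! hcon
      refine h ((Set.Finite.biUnion (Set.toFinite p.2) fun q hq =>
        hcon q hq).subset fun n hn => ?_)
      exact Set.mem_biUnion hn rfl

end Rabin

namespace Rabin

variable {Γ : Type w} (R : Rabin Γ)

theorem meets_suffix_iff (q : R.State) (x : ℕ → Γ) (n : ℕ) (p : Set R.State × Set R.State) :
    R.Meets (R.compFrom q x n) (suffix x n) p ↔ R.Meets q x p := by
  unfold Meets
  simp only [← compFrom_add]
  refine and_congr ?_ ?_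
  · conv_rhs => rw [← map_add_atTop_eq_nat n, eventually_map]
    simp only [add_comm n]
  · conv_rhs => rw [← map_add_atTop_eq_nat n, frequently_map]
    simp only [add_comm n]

/-- The condition `p` is met, and no violation of it occurs after the initial state. -/
def Honors (q : R.State) (x : ℕ → Γ) (p : Set R.State × Set R.State) : Prop :=
  (∀ n, R.compFrom q x (n + 1) ∉ p.1) ∧ ∃ᶠ n in atTop, R.compFrom q x n ∈ p.2

/-- The current state is exempt from the test for `E`, just as `evolveTag` only tests the successor.
An element may therefore be committed while it stands in `E`. -/
theorem honors_iff (q : R.State) (x : ℕ → Γ) (p : Set R.State × Set R.State) :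
    R.Honors q x p ↔ R.δ q (x 0) ∉ p.1 ∧ R.Honors (R.δ q (x 0)) (suffix x 1) p := by
  unfold Honors
  rw [← and_assoc]
  refine and_congr ?_ ?_
  · refine ⟨fun h => ⟨h 0, fun n => ?_⟩, fun ⟨h, h'⟩ n => ?_⟩
    · rw [← compFrom_succ]
      exact h (n + 1)
    · cases n with
      | zero => exact h
      | succ n =>
        rw [compFrom_succ]
        exact h' n
  · conv_lhs => rw [← map_add_atTop_eq_nat 1, frequently_map]
    simp only [compFrom_succ]

variable {S : Type u} {A : Type v} {AP : Type w} {R : Rabin (Set AP)}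

theorem compFrom_congr (ν : S → Set AP) (q : R.State) {ω ω' : Run S A} {n : ℕ}
    (h : ω.hist n = ω'.hist n) :
    R.compFrom q (labels ν ω) n = R.compFrom q (labels ν ω') n := by
  induction n with
  | zero => rfl
  | succ n ih =>
    have h' := hist_eq_of_le n.le_succ h
    rw [compFrom, compFrom, ih h', labels, labels,
      show (ω n).1 = (ω' n).1 from congrArg Prod.snd h']

theorem measurableSet_compFrom [Finite S] [Finite A] (ν : S → Set AP) (q : R.State) (n : ℕ)
    (B : Set R.State) : MeasurableSet {ω : Run S A | R.compFrom q (labels ν ω) n ∈ B} := by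
  refine FinitelyDetermined.measurableSet ⟨n, fun ω ω' h hω => ?_⟩
  rw [Set.mem_ofPred_eq, ← compFrom_congr ν q h]
  exact hω

theorem measurableSet_frequently [Finite S] [Finite A] (ν : S → Set AP) (q : R.State)
    (B : Set R.State) :
    MeasurableSet {ω : Run S A | ∃ᶠ n in atTop, R.compFrom q (labels ν ω) n ∈ B} := by
  have : {ω : Run S A | ∃ᶠ n in atTop, R.compFrom q (labels ν ω) n ∈ B} =
      ⋂ m, ⋃ n, ⋃ (_ : m ≤ n), {ω | R.compFrom q (labels ν ω) n ∈ B} := by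
    ext ω
    simp [frequently_atTop]
  rw [this]
  exact MeasurableSet.iInter fun m => MeasurableSet.iUnion fun n => MeasurableSet.iUnion fun _ =>
    measurableSet_compFrom ν q n B

theorem measurableSet_honors [Finite S] [Finite A] (ν : S → Set AP) (q : R.State)
    (p : Set R.State × Set R.State) :
    MeasurableSet {ω : Run S A | R.Honors q (labels ν ω) p} := by
  refine MeasurableSet.inter ?_ (measurableSet_frequently ν q p.2)
  have : {ω : Run S A | ∀ n, R.compFrom q (labels ν ω) (n + 1) ∉ p.1} =
      ⋂ n, {ω | R.compFrom q (labels ν ω) (n + 1) ∈ p.1ᶜ} := by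
    ext ω
    simp
  change MeasurableSet {ω : Run S A | ∀ n, R.compFrom q (labels ν ω) (n + 1) ∉ p.1}
  rw [this]
  exact MeasurableSet.iInter fun n => measurableSet_compFrom ν q (n + 1) p.1ᶜ

theorem measurableSet_meets [Finite S] [Finite A] (ν : S → Set AP) (q : R.State)
    (p : Set R.State × Set R.State) :
    MeasurableSet {ω : Run S A | R.Meets q (labels ν ω) p} := by
  refine MeasurableSet.inter ?_ (measurableSet_frequently ν q p.2)
  have : {ω : Run S A | ∀ᶠ n in atTop, R.compFrom q (labels ν ω) n ∉ p.1} =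
      {ω : Run S A | ∃ᶠ n in atTop, R.compFrom q (labels ν ω) n ∈ p.1}ᶜ := by
    ext ω
    simp [Filter.Frequently]
  change MeasurableSet {ω : Run S A | ∀ᶠ n in atTop, R.compFrom q (labels ν ω) n ∉ p.1}
  rw [this]
  exact (measurableSet_frequently ν q p.1).compl

end Rabin

/-! ### Objectives attached to collections of automaton instances. -/

section Objectives

variable {S : Type u} {A : Type v} {AP : Type w} {ψ : Formula AP} {R : AutIdx ψ → Rabin (Set AP)}

/-- What an annotated automaton state demands of the word that is read from there. -/
def Wins (c : Config R) (x : ℕ → Set AP) : Prop :=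
  match c.2.2 with
  | .star => ∃ p ∈ (R c.1).acc, (R c.1).Meets c.2.1 x p
  | .circ p => (R c.1).Honors c.2.1 x p.1
  | .bullet p => (R c.1).Honors c.2.1 x p.1
  | .bot => False

/-- The demand is an invariant of the product dynamics: ☆ is a tail condition, and ○ and • make the
same demand, so moving between them, including the reset after fulfilment, costs nothing. -/
theorem wins_evolveConfig_iff (Cs : Set (Config R)) (c : Config R) (x : ℕ → Set AP) :
    Wins (evolveConfig Cs (x 0) c) (suffix x 1) ↔ Wins c x := by
  obtain ⟨k, q, tag⟩ := c
  cases tag with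
  | star =>
    refine exists_congr fun p => and_congr_right fun _ => ?_
    exact (R k).meets_suffix_iff q x 1 p
  | bot => exact Iff.rfl
  | circ p =>
    have h := (R k).honors_iff q x p.1
    by_cases hE : (R k).δ q (x 0) ∈ p.1.1
    · simp only [Wins, evolveConfig, evolveTag, if_pos hE, h]
      tauto
    · by_cases hF : (R k).δ q (x 0) ∈ p.1.2
      · simp only [Wins, evolveConfig, evolveTag, if_neg hE, if_pos hF, h]
        tauto
      · simp only [Wins, evolveConfig, evolveTag, if_neg hE, if_neg hF, h]
        tauto
  | bullet p =>
    have h := (R k).honors_iff q x p.1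
    by_cases hE : (R k).δ q (x 0) ∈ p.1.1
    · simp only [Wins, evolveConfig, evolveTag, if_pos hE, h]
      tauto
    · by_cases hF : (R k).δ q (x 0) ∈ p.1.2
      · simp only [Wins, evolveConfig, evolveTag, if_neg hE, if_pos hF, h]
        tauto
      · by_cases hC : Fulfilled Cs
        · simp only [Wins, evolveConfig, evolveTag, if_neg hE, if_neg hF, if_pos hC, h]
          tauto
        · simp only [Wins, evolveConfig, evolveTag, if_neg hE, if_neg hF, if_neg hC, h]
          tauto

theorem measurableSet_wins [Finite S] [Finite A] (ν : S → Set AP) (c : Config R) :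
    MeasurableSet {ω : Run S A | Wins c (labels ν ω)} := by
  obtain ⟨k, q, tag⟩ := c
  cases tag with
  | star =>
    have : {ω : Run S A | Wins (⟨k, q, .star⟩ : Config R) (labels ν ω)} =
        ⋃ p ∈ (R k).acc, {ω | (R k).Meets q (labels ν ω) p} := by
      ext ω
      simp [Wins]
    rw [this]
    exact MeasurableSet.biUnion (Set.toFinite _).countable
      fun p _ => Rabin.measurableSet_meets ν q p
  | bot => exact MeasurableSet.empty
  | circ p => exact Rabin.measurableSet_honors ν q p.1
  | bullet p => exact Rabin.measurableSet_honors ν q p.1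

/-- The runs that satisfy the demands of all elements of `C`. -/
def winning (ν : S → Set AP) (C : Set (Config R)) : Set (Run S A) :=
  {ω | ∀ c ∈ C, Wins c (labels ν ω)}

/-- The runs that satisfy the demands of `C` and exactly the frequency constraints in `I`. -/
def objective (ν : S → Set AP) (I : Choice ψ) (C : Set (Config R)) : Set (Run S A) :=
  {ω | ψ.satFreqs (labels ν ω) = I.1} ∩ winning ν C

/-- The objective, together with the demands of fresh instances in each of the next `k` steps. -/
def windowObjective (ν : S → Set AP) (I : Choice ψ) (k : ℕ) (C : Set (Config R)) :
    Set (Run S A) :=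
  objective ν I C ∩ {ω | ∀ j < k, ω.drop j ∈ winning ν (initConfigs R I)}

theorem measurableSet_winning [Finite S] [Finite A] (ν : S → Set AP) (C : Set (Config R)) :
    MeasurableSet (winning (A := A) ν C) := by
  have : winning (A := A) ν C = ⋂ c ∈ C, {ω | Wins c (labels ν ω)} := by
    ext; simp [winning]
  rw [this]
  exact MeasurableSet.biInter (Set.toFinite _).countable fun c _ => measurableSet_wins ν c

theorem measurableSet_satFreqs (ν : S → Set AP) (I : Choice ψ) :
    MeasurableSet {ω : Run S A | ψ.satFreqs (labels ν ω) = I.1} := by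
  have : {ω : Run S A | ψ.satFreqs (labels ν ω) = I.1} =
      ⋂ φ ∈ ψ.freqSubs, {ω | (Formula.freq φ).Sat (labels ν ω) ↔ φ ∈ I.1} := by
    ext ω
    simp only [Set.mem_ofPred_eq, Set.mem_iInter, Set.ext_iff, Formula.satFreqs]
    refine forall_congr' fun φ => ?_
    have := @I.2 φ
    tauto
  rw [this]
  refine MeasurableSet.biInter ψ.finite_freqSubs.countable fun φ _ => ?_
  by_cases h : φ ∈ I.1
  · simpa only [h, iff_true] using Formula.measurableSet_sat ν (.freq φ)
  · simp only [h, iff_false]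
    exact (Formula.measurableSet_sat ν (.freq φ)).compl

theorem measurableSet_objective [Finite S] [Finite A] (ν : S → Set AP) (I : Choice ψ)
    (C : Set (Config R)) : MeasurableSet (objective (A := A) ν I C) :=
  (measurableSet_satFreqs ν I).inter (measurableSet_winning ν C)

theorem measurableSet_windowObjective [Finite S] [Finite A] (ν : S → Set AP) (I : Choice ψ)
    (k : ℕ) (C : Set (Config R)) : MeasurableSet (windowObjective (A := A) ν I k C) := by
  refine (measurableSet_objective ν I C).inter ?_
  have : {ω : Run S A | ∀ j < k, ω.drop j ∈ winning ν (initConfigs R I)} =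
      ⋂ j, ⋂ (_ : j < k), {ω | ω.drop j ∈ winning ν (initConfigs R I)} := by
    ext; simp
  rw [this]
  exact MeasurableSet.iInter fun j => MeasurableSet.iInter fun _ =>
    measurable_drop j (measurableSet_winning ν _)

theorem drop_one_mem_objective_iff (ν : S → Set AP) (I : Choice ψ) (Cs C : Set (Config R))
    (ω : Run S A) :
    ω.drop 1 ∈ objective ν I (evolveConfig Cs (ν (ω 0).1) '' C) ↔ ω ∈ objective ν I C := by
  refine and_congr ?_ ?_
  · exact iff_of_eq (congrArg (· = I.1) (ψ.satFreqs_suffix (labels ν ω) 1))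
  · change (∀ c ∈ _, Wins c (suffix (labels ν ω) 1)) ↔ _
    rw [Set.forall_mem_image]
    exact forall₂_congr fun c _ => wins_evolveConfig_iff Cs c (labels ν ω)

theorem mem_objective_of_cons (ν : S → Set AP) (I : Choice ψ) (Cs C : Set (Config R)) {p : S × A}
    {ω : Run S A} (h : Run.cons p ω ∈ objective ν I C) :
    ω ∈ objective ν I (evolveConfig Cs (ν p.1) '' C) := by
  have := (drop_one_mem_objective_iff ν I Cs C (Run.cons p ω)).2 h
  rwa [Run.drop_one_cons] at this

/-- The instances demanded at time 0 are absorbed into the collection before the step, and the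
remaining window is shorter by one. -/
theorem mem_windowObjective_of_cons (ν : S → Set AP) (I : Choice ψ) (k : ℕ)
    (Cs C : Set (Config R)) {p : S × A} {ω : Run S A}
    (h : Run.cons p ω ∈ windowObjective ν I (k + 1) C) :
    ω ∈ windowObjective ν I k (evolveConfig Cs (ν p.1) '' (C ∪ initConfigs R I)) := by
  refine ⟨mem_objective_of_cons ν I Cs _ ⟨h.1.1, fun c hc => hc.elim (h.1.2 c) ?_⟩, fun j hj => ?_⟩
  · have := h.2 0 (Nat.succ_pos k)
    rw [Run.drop_zero] at this
    exact this c
  · have := h.2 (1 + j) (by lia)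
    rwa [← Run.drop_drop, Run.drop_one_cons] at this

/-- The collection evolves without changes by the strategy. -/
def drift (ν : S → Set AP) (C : Set (Config R)) (s : S) : Set (Config R) :=
  evolveConfig C (ν s) '' C

theorem drop_mem_objective_iff (ν : S → Set AP) (I : Choice ψ) (C : Set (Config R))
    (ω : Run S A) (n : ℕ) :
    ω.drop n ∈ objective ν I (MDP.trace (drift ν) C ω n) ↔ ω ∈ objective ν I C := by
  induction n with
  | zero => rw [Run.drop_zero]; rfl
  | succ n ih =>
    rw [← ih, ← Run.drop_drop]
    exact drop_one_mem_objective_iff ν I _ _ (ω.drop n)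

/-- Along a run that satisfies exactly the frequency constraints in `I`, fresh instances of the
corresponding automata accept with frequency one. -/
theorem tendsto_frequency_not_winning {M : MDP S A} {ν : S → Set AP} (hR : Represents M ν R)
    (I : Choice ψ) {ω : Run S A} (hω : M.IsRun ω) (hI : ψ.satFreqs (labels ν ω) = I.1) :
    Tendsto (frequency fun j => ω.drop j ∉ winning ν (initConfigs R I)) atTop (nhds 0) := by
  have hfin : Finite I.1 := (ψ.finite_freqSubs.subset I.2).to_subtype
  have h1 : ∀ φ : I.1, Tendsto (frequency fun j => ¬ φ.1.Sat (suffix (labels ν ω) j)) atTop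
      (nhds 0) := by
    intro φ
    rw [← Formula.freq_sat_iff]
    have : φ.1 ∈ ψ.satFreqs (labels ν ω) := by
      rw [hI]
      exact φ.2
    exact this.2
  refine squeeze_zero (fun n => frequency_nonneg _ _) (fun n => frequency_mono (fun j hj => ?_) n)
    (tendsto_frequency_exists h1)
  by_contra! hcon
  refine hj ?_
  rintro c ⟨φ, hφ, rfl⟩
  have h2 := hcon ⟨φ, hφ⟩
  have hrun : M.IsRun (ω.drop j) := fun n => hω (j + n)
  have h3 : ψ.satFreqs (suffix (labels ν ω) j) = I.1 := by rw [Formula.satFreqs_suffix, hI]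
  -- The suffix also satisfies exactly the constraints in `I`, so there φ and its resolution agree,
  -- and the automaton for the resolution accepts.
  rw [← Formula.sat_resolve_iff φ (Formula.freqSubs_subset (I.2 hφ)) _ h3] at h2
  exact ((R _).accepts_iff _).1 ((hR (subIdx I φ (I.2 hφ)) _ hrun).2 h2)

end Objectives

/-! ### Steps of the product and bounds on the loss. -/

namespace MDP

variable {S : Type u} {A : Type v} {AP : Type w} {ψ : Formula AP} {R : AutIdx ψ → Rabin (Set AP)}

theorem product_enabled {M : MDP S A} {ν : S → Set AP} {I : Choice ψ} {s : S} {a : A}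
    {C Ca : Set (Config R)} (hl : Legal I C Ca) (ha : M.Enabled s a) :
    (product M ν R I).Enabled (s, C) (a, Ca) := by
  unfold Enabled at ha ⊢
  unfold product
  simpa [hl] using ha

theorem product_step {M : MDP S A} {ν : S → Set AP} {I : Choice ψ} {s : S} {a : A}
    {C Ca : Set (Config R)} (hl : Legal I C Ca) (ha : M.Enabled s a) :
    (product M ν R I).step (s, C) (a, Ca) =
      (M.step s a).map fun t => (t, evolveConfig C (ν s) '' Ca) := by
  obtain ⟨d, hd⟩ := Option.isSome_iff_exists.1 ha
  unfold step product
  simp [hl, hd]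

theorem product_step_ne_zero_iff {M : MDP S A} {ν : S → Set AP} {I : Choice ψ} {s : S} {a : A}
    {C Ca : Set (Config R)} (hl : Legal I C Ca) (ha : M.Enabled s a) (x : S × Set (Config R)) :
    (product M ν R I).step (s, C) (a, Ca) x ≠ 0 ↔
      ∃ t, M.step s a t ≠ 0 ∧ x = (t, evolveConfig C (ν s) '' Ca) := by
  rw [product_step hl ha, ← PMF.mem_support_iff, PMF.support_map]
  simp only [Set.mem_image, PMF.mem_support_iff, eq_comm]

theorem legal_self (I : Choice ψ) (C : Set (Config R)) : Legal I C C :=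
  ⟨fun _ _ h => Or.inl h, fun _ _ _ _ h => h, fun _ _ _ h => Or.inl h⟩

theorem legal_union_initConfigs (I : Choice ψ) (C : Set (Config R)) :
    Legal I C (C ∪ initConfigs R I) :=
  ⟨fun _ _ h => Or.inl (Or.inl h), fun _ _ _ _ h => Or.inl h,
    fun _ _ _ h => h.imp id Or.inr⟩

open Classical in
theorem Reaches.product_step {M : MDP S A} {ν : S → Set AP} {I : Choice ψ}
    {V F T : Set (S × Set (Config R))} {b : Bool} {s t : S} {a : A} {C Ca : Set (Config R)}
    (hl : Legal I C Ca) (ha : M.Enabled s a)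
    (hV : ∀ t, M.step s a t ≠ 0 → (t, evolveConfig C (ν s) '' Ca) ∈ V) (ht : M.step s a t ≠ 0)
    (h : Reaches (product M ν R I) V F T (b || decide ((t, evolveConfig C (ν s) '' Ca) ∈ F))
      (t, evolveConfig C (ν s) '' Ca)) : Reaches (product M ν R I) V F T b (s, C) := by
  refine Reaches.step (t := (t, evolveConfig C (ν s) '' Ca)) (product_enabled hl ha) ?_
    ((product_step_ne_zero_iff hl ha _).2 ⟨t, ht, rfl⟩) h
  intro x hx
  obtain ⟨t, ht, rfl⟩ := (product_step_ne_zero_iff hl ha x).1 hx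
  exact hV t ht

theorem loss_mono [Finite S] [Finite A] {M : MDP S A} (s : S) {Y Y' : Set (Run S A)}
    (h : Y ⊆ Y') : M.loss s Y' ≤ M.loss s Y :=
  iInf_mono fun _ => measure_mono (Set.compl_subset_compl.2 h)

/-- The conditional probability to miss an objective after a history bounds the loss. -/
theorem loss_le_of_cyl [Finite S] [Finite A] {M : MDP S A} (σ : M.Strategy) (s : S)
    {h : Hist S A} (h0 : σ.prob s (cyl h) ≠ 0) {Y : Set (Run S A)} (hY : MeasurableSet Y)
    {ε : ENNReal} (hε : σ.prob s (cyl h ∩ {ω | ω.drop h.1.length ∈ Yᶜ}) ≤ ε * σ.prob s (cyl h)) :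
    M.loss h.2 Y ≤ ε := by
  rw [prob_cyl_inter_drop σ s h hY.compl, mul_comm,
    ENNReal.mul_le_mul_iff_left h0 (measure_ne_top _ _)] at hε
  exact (loss_le _ _ _).trans hε

end MDP

/-- A decreasing sequence of sets in a finite type has equal consecutive members. -/
theorem exists_eq_succ_of_antitone {X : Type*} [Finite X] {B : ℕ → Set X} (hB : Antitone B) :
    ∃ k, B (k + 1) = B k := by
  by_contra! hcon
  have h : ∀ n, (B n).ncard + n ≤ (B 0).ncard := by
    intro n
    induction n with
    | zero => simp
    | succ n ih =>
      have := Set.ncard_lt_ncard ((hB n.le_succ).lt_of_ne (hcon n)) (Set.toFinite _)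
      lia
  have := h ((B 0).ncard + 1)
  lia

theorem three_eighths_lt_half {ε : ENNReal} (h0 : ε ≠ 0) (h : ε ≠ ⊤) :
    ε / 8 + ε / 8 + ε / 8 < ε / 2 := by
  have h8 : ε / 8 ≠ ⊤ := ENNReal.div_ne_top h (by simp)
  have hpos := ENNReal.toReal_pos h0 h
  rw [← ENNReal.toReal_lt_toReal (by simp [h8]) (ENNReal.div_ne_top h (by simp)),
    ENNReal.toReal_add (by simp [h8]) h8, ENNReal.toReal_add h8 h8, ENNReal.toReal_div,
    ENNReal.toReal_div]
  norm_num
  linarith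

/-! ### Secure states, the closed set, and reaching it. -/

section Main

variable {S : Type u} {A : Type v} {AP : Type w} {ψ : Formula AP} {R : AutIdx ψ → Rabin (Set AP)}

/-- The product states from which the objective can be met with probability arbitrarily close
to one. -/
def secure [Finite S] [Finite A] (M : MDP S A) (ν : S → Set AP) (I : Choice ψ) :
    Set (S × Set (Config R)) :=
  {x | M.loss x.1 (objective ν I x.2) = 0}

/-- No element of the collection is undecided. -/
def Decided (C : Set (Config R)) : Prop := ∀ c ∈ C, c.2.2 ≠ Tag.star

theorem evolveTag_eq_star_iff {Q : Type} {acc : Set (Set Q × Set Q)} (Cs : Set (Config R)) (q : Q)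
    (x : Tag {p : Set Q × Set Q // p ∈ acc}) : evolveTag Cs q x = .star ↔ x = .star := by
  cases x with
  | star => exact Iff.rfl
  | bot => exact Iff.rfl
  | circ p => simp only [evolveTag]; split_ifs <;> simp
  | bullet p => simp only [evolveTag]; split_ifs <;> simp

theorem Decided.image {C : Set (Config R)} (h : Decided C) (Cs : Set (Config R)) (b : Set AP) :
    Decided (evolveConfig Cs b '' C) := by
  rintro _ ⟨c, hc, rfl⟩ h'
  exact h c hc ((evolveTag_eq_star_iff _ _ _).1 h')

/-- The states from which fresh instances can be started forever form a set that can be left alone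
once a long enough window with fresh instances is possible. -/
theorem exists_closed_set [Finite S] [Finite A] (M : MDP S A) (ν : S → Set AP) (I : Choice ψ) :
    ∃ (T : Set (S × Set (Config R))) (K : ℕ), T ⊆ secure M ν I ∧
      (∀ x, M.loss x.1 (windowObjective ν I K x.2) = 0 → x ∈ T) ∧
      ∀ x ∈ T, ∃ y ∈ {y : A × Set (Config R) | initConfigs R I ⊆ y.2},
        (product M ν R I).Enabled x y ∧
        ∀ t, (product M ν R I).step x y t ≠ 0 → t ∈ T := by
  let B : ℕ → Set (S × Set (Config R)) := fun k =>
    {x | M.loss x.1 (windowObjective ν I k x.2) = 0}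
  have hB : Antitone B := by
    intro k l hkl x hx
    refine le_antisymm (le_trans (MDP.loss_mono _ ?_) (le_of_eq hx)) zero_le
    exact fun ω hω => ⟨hω.1, fun j hj => hω.2 j (hj.trans_le hkl)⟩
  obtain ⟨K, hK⟩ := exists_eq_succ_of_antitone hB
  refine ⟨B K, K, fun x hx => ?_, fun x hx => hx, fun x hx => ?_⟩
  · refine le_antisymm (le_trans (MDP.loss_mono _ ?_) (le_of_eq hx)) zero_le
    exact fun ω hω => hω.1
  · obtain ⟨s, C⟩ := x
    -- Stabilisation supplies one more step of window, which is spent on starting the fresh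
    -- instances now.
    rw [← hK] at hx
    obtain ⟨a, ha, hat⟩ := MDP.exists_action_loss_eq_zero
      (Y' := windowObjective ν I K (evolveConfig C (ν s) '' (C ∪ initConfigs R I)))
      (measurableSet_windowObjective ν I (K + 1) C)
      (fun a ω h => mem_windowObjective_of_cons ν I K C C h) hx
    have hl := MDP.legal_union_initConfigs (R := R) I C
    refine ⟨(a, C ∪ initConfigs R I), Set.subset_union_right, MDP.product_enabled hl ha, ?_⟩
    intro t ht
    obtain ⟨t', ht', rfl⟩ := (MDP.product_step_ne_zero_iff hl ha t).1 ht
    exact hat t' ht'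

/-- From a secure state of `D`, some strategy meets the objective and never leaves `D`, both with
high probability. -/
theorem exists_strategy_stays [Finite S] [Finite A] (M : MDP S A) (ν : S → Set AP) (I : Choice ψ)
    {D : Set (S × Set (Config R))}
    (hD : ∀ s C, (s, C) ∈ D → ∀ a, M.Enabled s a →
        (∀ t, M.step s a t ≠ 0 → (t, drift ν C s) ∈ secure M ν I) →
        ∀ t, M.step s a t ≠ 0 → (t, drift ν C s) ∈ D)
    {s : S} {C : Set (Config R)} (hs : (s, C) ∈ secure M ν I) (hsD : (s, C) ∈ D)
    {ε : ENNReal} (hε : ε ≠ 0) :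
    ∃ σ : M.Strategy, σ.prob s (objective ν I C)ᶜ ≤ ε ∧
      σ.prob s (MDP.stays (drift ν) D C)ᶜ ≤ ε := by
  obtain ⟨κ, hκ, hκ1, hst⟩ := MDP.exists_mul_prob_stays_compl_le (K := Set (Config R)) (drift ν) M
    (objective ν I) (measurableSet_objective ν I)
    (fun C p ω h => mem_objective_of_cons ν I C C h)
  rcases eq_or_ne ε ⊤ with rfl | hε'
  · obtain ⟨σ, -⟩ := MDP.exists_prob_compl_lt hs one_ne_zero
    exact ⟨σ, le_top, le_top⟩
  -- Missing the objective with probability below κ · ε bounds the probability of leaving `D` by ε.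
  obtain ⟨σ, hσ⟩ := MDP.exists_prob_compl_lt hs (mul_ne_zero hκ hε)
  refine ⟨σ, hσ.le.trans (mul_le_of_le_one_left zero_le hκ1), ?_⟩
  have := (hst D hD s C hsD σ).trans hσ.le
  exact (ENNReal.mul_le_mul_iff_right hκ (ne_top_of_le_ne_top ENNReal.one_ne_top hκ1)).1 this

theorem prob_inter_ne_zero [Finite S] [Finite A] {M : MDP S A} (σ : M.Strategy) (s : S)
    {Y D : Set (Run S A)} (h : σ.prob s Yᶜ + σ.prob s Dᶜ < 1) : σ.prob s (Y ∩ D) ≠ 0 := by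
  intro h0
  have h1 : σ.prob s Set.univ ≤ σ.prob s (Y ∩ D) + (σ.prob s Yᶜ + σ.prob s Dᶜ) := by
    refine le_trans (measure_mono fun ω _ => ?_) ((measure_union_le _ _).trans
      (add_le_add le_rfl (measure_union_le Yᶜ Dᶜ)))
    by_cases hY : ω ∈ Y
    · by_cases hD : ω ∈ D
      · exact Or.inl ⟨hY, hD⟩
      · exact Or.inr (Or.inr hD)
    · exact Or.inr (Or.inl hY)
  rw [h0, zero_add, measure_univ] at h1
  exact absurd h (not_lt.2 h1)

/-- An objective with a high enough conditional probability after a history has loss zero. -/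
theorem loss_eq_zero_of_cyl [Finite S] [Finite A] {M : MDP S A} {ε : ENNReal} (hε0 : ε ≠ 0)
    (hε : ε ≠ ⊤) (σ : M.Strategy) (s : S) {h : Hist S A} (h0 : σ.prob s (cyl h) ≠ 0)
    {Y Z : Set (Run S A)} (hY : MeasurableSet Y) (hgap : M.loss h.2 Y ≠ 0 → ε ≤ M.loss h.2 Y)
    (hsub : ∀ ω ∈ cyl h, ω ∈ Z → ω.drop h.1.length ∈ Y)
    (hZ : σ.prob s (cyl h ∩ Zᶜ) ≤ ε / 2 * σ.prob s (cyl h)) : M.loss h.2 Y = 0 := by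
  by_contra hne
  refine absurd (ENNReal.half_lt_self hε0 hε) (not_lt.2 ((hgap hne).trans ?_))
  refine MDP.loss_le_of_cyl σ s h0 hY (le_trans (measure_mono ?_) hZ)
  exact fun ω hω => ⟨hω.1, fun h' => hω.2 (hsub ω hω.1 h')⟩

open Classical in
/-- From secure states, the set `T` can be reached safely. -/
theorem reaches_of_flag [Finite S] [Finite A] {M : MDP S A} {ν : S → Set AP}
    (hR : Represents M ν R) (I : Choice ψ) {T F : Set (S × Set (Config R))} {K : ℕ}
    (hT : ∀ x, M.loss x.1 (windowObjective ν I K x.2) = 0 → x ∈ T)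
    {x : S × Set (Config R)} (hx : x ∈ secure M ν I) :
    MDP.Reaches (product M ν R I) (secure M ν I) F T true x := by
  by_contra hcon
  -- Playing the collection unchanged is legal, so a path from a safe successor would extend
  -- backwards; hence `D` is closed under safe steps.
  let D : Set (S × Set (Config R)) :=
    {x | x ∈ secure M ν I ∧ ¬ MDP.Reaches (product M ν R I) (secure M ν I) F T true x}
  have hD : ∀ s C, (s, C) ∈ D → ∀ a, M.Enabled s a →
        (∀ t, M.step s a t ≠ 0 → (t, drift ν C s) ∈ secure M ν I) →
        ∀ t, M.step s a t ≠ 0 → (t, drift ν C s) ∈ D :=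
    fun s C hsC a ha hsafe t ht => ⟨hsafe t ht, fun hr => hsC.2
      (MDP.Reaches.product_step (MDP.legal_self I C) ha hsafe ht (by rwa [Bool.true_or]))⟩
  obtain ⟨ε, hε, hε1, hgap⟩ := exists_gap fun x : S × Set (Config R) =>
    M.loss x.1 (windowObjective ν I K x.2)
  have hεt : ε ≠ ⊤ := ne_top_of_le_ne_top ENNReal.one_ne_top hε1
  obtain ⟨s, C⟩ := x
  have hε8 : ε / 8 ≠ 0 := ENNReal.div_ne_zero.2 ⟨hε, by simp⟩
  obtain ⟨σ, h1, h2⟩ := exists_strategy_stays M ν I hD hx ⟨hx, hcon⟩ hε8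
  -- Intersecting with the objective makes the failure frequency vanish almost surely on the whole
  -- space: outside the objective there is nothing to count.
  let Q : ℕ → Set (Run S A) := fun j =>
    objective ν I C ∩ {ω | ω.drop j ∈ (winning ν (initConfigs R I))ᶜ}
  have hQ : ∀ j, MeasurableSet (Q j) := fun j => (measurableSet_objective ν I C).inter
    (measurable_drop j (measurableSet_winning ν _).compl)
  obtain ⟨n, hn⟩ := exists_window_measure_lt (σ.prob s) hQ (by
    filter_upwards [MDP.ae_isRun σ s] with ω hω
    by_cases hO : ω ∈ objective ν I C
    · exact squeeze_zero (fun n => frequency_nonneg _ _)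
        (fun n => frequency_mono (fun j hj => hj.2) n)
        (tendsto_frequency_not_winning hR I hω hO.1)
    · refine squeeze_zero (fun n => frequency_nonneg _ _)
        (fun n => frequency_mono (Q := fun _ => False) (fun j hj => hO hj.1) n) ?_
      have h0 : frequency (fun _ => False) = fun _ => 0 := by
        funext n
        simp [frequency]
      rw [h0]
      exact tendsto_const_nhds) K hε8
  let Y : Set (Run S A) := objective ν I C ∩ (⋃ i ∈ Finset.range K, Q (n + i))ᶜ
  have hYm : MeasurableSet Y := (measurableSet_objective ν I C).inter
    (MeasurableSet.biUnion (Finset.range K).countable_toSet fun i _ => hQ (n + i)).compl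
  have hYc : σ.prob s Yᶜ ≤ ε / 8 + ε / 8 := by
    have : Yᶜ ⊆ (objective ν I C)ᶜ ∪ ⋃ i ∈ Finset.range K, Q (n + i) := by
      rw [Set.compl_inter, compl_compl]
    refine (measure_mono this).trans ((measure_union_le _ _).trans (add_le_add h1 ?_))
    exact (measure_biUnion_finset_le _ _).trans hn.le
  -- The three shares of ε / 8 are for missing the objective, for a failure within the window, and
  -- for leaving `D`.
  have hsum : σ.prob s Yᶜ + σ.prob s (MDP.stays (drift ν) D C)ᶜ < ε / 2 := by
    exact lt_of_le_of_lt (add_le_add hYc h2) (three_eighths_lt_half hε hεt)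
  obtain ⟨h, hlen, hD0, hYh⟩ := exists_cyl_of_measure_compl_lt (σ.prob s) n hYm
    (MDP.measurableSet_stays (drift ν) D C) (ENNReal.half_le_self.trans hε1) hsum
  obtain ⟨ω, hω, hωD⟩ := nonempty_of_measure_ne_zero hD0
  have h0 : σ.prob s (cyl h) ≠ 0 := fun h' => hD0 (measure_mono_null Set.inter_subset_left h')
  have hωh : ω.hist n = h := hlen ▸ cyl_hist_eq hω
  have hlast : (ω n).1 = h.2 := congrArg Prod.snd hωh
  have hmem := hωD n
  rw [hlast] at hmem
  -- The bit is already set, so membership in `T` counts as reaching it in zero steps and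
  -- contradicts membership in `D`.
  refine hmem.2 ⟨0, rfl, hT _ ?_⟩
  refine loss_eq_zero_of_cyl hε hεt σ s h0 (measurableSet_windowObjective ν I K _)
    (hgap (h.2, MDP.trace (drift ν) C ω n)) (Z := Y) ?_ hYh
  intro ω' hω' hY'
  have hω'h : ω'.hist n = h := hlen ▸ cyl_hist_eq hω'
  rw [hlen, MDP.trace_congr (drift ν) C (hωh.trans hω'h.symm)]
  refine ⟨(drop_mem_objective_iff ν I C ω' n).2 hY'.1, fun i hi => ?_⟩
  rw [Run.drop_drop]
  by_contra hw
  exact hY'.2 (Set.mem_biUnion (x := i) (by simpa using hi) ⟨hY'.1, hw⟩)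

/-! ### Decided collections become fulfilled. -/

/-- The development of one element of the collection `C` along a run. -/
noncomputable def path (ν : S → Set AP) (C : Set (Config R)) (ω : Run S A) (c : Config R) : ℕ → Config R
  | 0 => c
  | n + 1 => evolveConfig (MDP.trace (drift ν) C ω n) (ν (ω n).1) (path ν C ω c n)

theorem trace_drift_eq (ν : S → Set AP) (C : Set (Config R)) (ω : Run S A) (n : ℕ) :
    MDP.trace (drift ν) C ω n = (fun c => path ν C ω c n) '' C := by
  induction n with
  | zero => simp [MDP.trace, path]
  | succ n ih =>
    rw [MDP.trace, drift]
    conv_lhs => rw [ih]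
    rw [Set.image_image]
    simp only [path, ih]

/-- An honored element carries a bullet from some time on, unless the collection is fulfilled. -/
theorem exists_forall_path_bullet (ν : S → Set AP) {C : Set (Config R)} {ω : Run S A}
    (hC : ∀ n, ¬ Fulfilled (MDP.trace (drift ν) C ω n)) {c : Config R} (hc : Wins c (labels ν ω))
    (hs : c.2.2 ≠ Tag.star) :
    ∃ m, ∀ n ≥ m, ∃ p, (path ν C ω c n).2.2 = Tag.bullet p := by
  obtain ⟨k, q, tag⟩ := c
  obtain ⟨p, htag, hon⟩ : ∃ p, (tag = .circ p ∨ tag = .bullet p) ∧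
      (R k).Honors q (labels ν ω) p.1 := by
    cases tag with
    | star => exact absurd rfl hs
    | bot => exact hc.elim
    | circ p => exact ⟨p, Or.inl rfl, hc⟩
    | bullet p => exact ⟨p, Or.inr rfl, hc⟩
  have hpath : ∀ n, path ν C ω ⟨k, q, tag⟩ n = ⟨k, (R k).compFrom q (labels ν ω) n, .circ p⟩ ∨
      path ν C ω ⟨k, q, tag⟩ n = ⟨k, (R k).compFrom q (labels ν ω) n, .bullet p⟩ := by
    intro n
    induction n with
    | zero =>
      rcases htag with rfl | rfl
      exacts [Or.inl rfl, Or.inr rfl]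
    | succ n ih =>
      have hE : (R k).δ ((R k).compFrom q (labels ν ω) n) (ν (ω n).1) ∉ p.1.1 := hon.1 n
      rcases ih with ih | ih
      · rw [path, ih]
        by_cases hF : (R k).δ ((R k).compFrom q (labels ν ω) n) (ν (ω n).1) ∈ p.1.2
        · refine Or.inr ?_
          simp only [evolveConfig, evolveTag, if_neg hE, if_pos hF]
          rfl
        · refine Or.inl ?_
          simp only [evolveConfig, evolveTag, if_neg hE, if_neg hF]
          rfl
      · rw [path, ih]
        refine Or.inr ?_
        simp only [evolveConfig, evolveTag, if_neg hE, if_neg (hC n), ite_self]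
        rfl
  -- The visit to `F` is taken at a positive time because a bullet is earned on entering `F`, not by
  -- standing there initially.
  obtain ⟨m, hm, hmF⟩ := (frequently_atTop.1 hon.2) 1
  obtain ⟨m, rfl⟩ := Nat.exists_eq_add_of_le' hm
  have hmF' : (R k).δ ((R k).compFrom q (labels ν ω) m) (ν (ω m).1) ∈ p.1.2 := hmF
  have hb : ∀ n ≥ m + 1,
      path ν C ω ⟨k, q, tag⟩ n = ⟨k, (R k).compFrom q (labels ν ω) n, .bullet p⟩ := by
    intro n hn
    induction n, hn using Nat.le_induction with
    | base =>
      have hE : (R k).δ ((R k).compFrom q (labels ν ω) m) (ν (ω m).1) ∉ p.1.1 := hon.1 m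
      rcases hpath m with ih | ih
      · rw [path, ih]
        simp only [evolveConfig, evolveTag, if_neg hE, if_pos hmF']
        rfl
      · rw [path, ih]
        simp only [evolveConfig, evolveTag, if_neg hE, if_pos hmF']
        rfl
    | succ n hn ih =>
      have hE : (R k).δ ((R k).compFrom q (labels ν ω) n) (ν (ω n).1) ∉ p.1.1 := hon.1 n
      rw [path, ih]
      simp only [evolveConfig, evolveTag, if_neg hE, if_neg (hC n), ite_self]
      rfl
  refine ⟨m + 1, fun n hn => ?_⟩
  rw [hb n hn]
  exact ⟨p, rfl⟩

/-- A decided collection all of whose demands are met becomes fulfilled. -/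
theorem exists_fulfilled_trace (ν : S → Set AP) (I : Choice ψ) {C : Set (Config R)}
    (hC : Decided C) {ω : Run S A} (hω : ω ∈ objective ν I C) :
    ∃ n, Fulfilled (MDP.trace (drift ν) C ω n) := by
  by_contra! hcon
  have h : ∀ c ∈ C, ∃ m, ∀ n ≥ m, ∃ p, (path ν C ω c n).2.2 = Tag.bullet p := fun c hc =>
    exists_forall_path_bullet ν hcon (hω.2 c hc) (hC c hc)
  have h' : ∀ᶠ n in atTop, ∀ c ∈ C, ∃ p, (path ν C ω c n).2.2 = Tag.bullet p :=
    (eventually_all_finite (Set.toFinite C)).2 fun c hc => eventually_atTop.2 (h c hc)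
  obtain ⟨n, hn⟩ := h'.exists
  refine hcon n ?_
  rw [trace_drift_eq]
  rintro _ ⟨c, hc, rfl⟩
  exact hn c hc

open Classical in
/-- The secure states that are not fulfilled and cannot reach `T` are closed under safe steps. -/
theorem closed_of_not_reaches [Finite S] [Finite A] {M : MDP S A} {ν : S → Set AP} {I : Choice ψ}
    {T : Set (S × Set (Config R))}
    (hT : ∀ x ∈ secure M ν I, MDP.Reaches (product M ν R I) (secure M ν I)
      {x | Fulfilled x.2} T true x) (s : S) (C : Set (Config R))
    (hsC : (s, C) ∈ {x | x ∈ secure M ν I ∧ ¬ Fulfilled x.2 ∧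
      ¬ MDP.Reaches (product M ν R I) (secure M ν I) {x | Fulfilled x.2} T false x})
    (a : A) (ha : M.Enabled s a)
    (hsafe : ∀ t, M.step s a t ≠ 0 → (t, drift ν C s) ∈ secure M ν I)
    (t : S) (ht : M.step s a t ≠ 0) :
    (t, drift ν C s) ∈ {x | x ∈ secure M ν I ∧ ¬ Fulfilled x.2 ∧
      ¬ MDP.Reaches (product M ν R I) (secure M ν I) {x | Fulfilled x.2} T false x} := by
  have key : ¬ MDP.Reaches (product M ν R I) (secure M ν I) {x | Fulfilled x.2} T
      (false || decide ((t, drift ν C s) ∈ {x : S × Set (Config R) | Fulfilled x.2}))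
      (t, drift ν C s) := fun hr => hsC.2.2
    (MDP.Reaches.product_step (MDP.legal_self I C) ha hsafe ht hr)
  -- A fulfilled successor would set the bit, and from a set bit `T` is reachable by hypothesis.
  have hnF : ¬ Fulfilled (drift ν C s) := by
    intro hF
    rw [decide_eq_true (show (t, drift ν C s) ∈ {x : S × Set (Config R) | Fulfilled x.2} from hF)]
      at key
    exact key (hT _ (hsafe t ht))
  rw [decide_eq_false (show (t, drift ν C s) ∉ {x : S × Set (Config R) | Fulfilled x.2} from hnF)]
    at key
  exact ⟨hsafe t ht, hnF, key⟩

-- Otherwise a near-optimal strategy would, with positive probability, meet the objective and see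
-- only unfulfilled collections, although on such runs all bullets eventually coincide.
open Classical in
theorem reaches_of_decided [Finite S] [Finite A] {M : MDP S A} {ν : S → Set AP} {I : Choice ψ}
    {T : Set (S × Set (Config R))}
    (hT : ∀ x ∈ secure M ν I, MDP.Reaches (product M ν R I) (secure M ν I)
      {x | Fulfilled x.2} T true x)
    {s : S} {C : Set (Config R)} (hs : (s, C) ∈ secure M ν I) (hC : Decided C)
    (hF : ¬ Fulfilled C) :
    MDP.Reaches (product M ν R I) (secure M ν I) {x | Fulfilled x.2} T false (s, C) := by
  by_contra hcon
  let D : Set (S × Set (Config R)) := {x | x ∈ secure M ν I ∧ ¬ Fulfilled x.2 ∧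
    ¬ MDP.Reaches (product M ν R I) (secure M ν I) {x | Fulfilled x.2} T false x}
  -- The value 1/8 is only chosen so that the two failure probabilities sum to less than one.
  obtain ⟨σ, h1, h2⟩ := exists_strategy_stays M ν I (D := D)
    (closed_of_not_reaches hT) hs ⟨hs, hF, hcon⟩ (ε := 1 / 8) (by simp)
  have hne := prob_inter_ne_zero σ s ((add_le_add h1 h2).trans_lt
    ((le_self_add.trans_lt (three_eighths_lt_half one_ne_zero ENNReal.one_ne_top)).trans_le
      ENNReal.half_le_self))
  obtain ⟨ω, hω, hωD⟩ := nonempty_of_measure_ne_zero hne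
  obtain ⟨n, hn⟩ := exists_fulfilled_trace ν I hC hω
  exact (hωD n).2.1 hn

end Main

/-! ### Committing undecided elements to accepting conditions. -/

namespace Rabin

variable {Γ : Type w} {R : Rabin Γ} {q : R.State} {x : ℕ → Γ} {p : Set R.State × Set R.State}

theorem Honors.suffix (h : R.Honors q x p) (n : ℕ) :
    R.Honors (R.compFrom q x n) (suffix x n) p := by
  induction n with
  | zero =>
    have : FreqLTL.suffix x 0 = x := by
      funext n
      exact congrArg x (zero_add n)
    rwa [this]
  | succ n ih =>
    rw [← suffix_suffix]
    exact ((R.honors_iff _ _ _).1 ih).2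

/-- After its last visit to `E`, a run that meets a condition also honors it. This is when a ☆ may
safely be replaced by ○. -/
theorem Meets.eventually_honors (h : R.Meets q x p) :
    ∀ᶠ n in atTop, R.Honors (R.compFrom q x n) (FreqLTL.suffix x n) p := by
  obtain ⟨N, hN⟩ := eventually_atTop.1 h.1
  filter_upwards [eventually_ge_atTop N] with n hn
  refine ⟨fun m => ?_, ((R.meets_suffix_iff q x n p).2 h).2⟩
  rw [← compFrom_add]
  exact hN _ (by lia)

end Rabin

section Commit

variable {S : Type u} {A : Type v} {AP : Type w} {ψ : Formula AP} {R : AutIdx ψ → Rabin (Set AP)}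

/-- The configuration `c` after reading `n` letters, with its annotation unchanged. -/
def advance (x : ℕ → Set AP) (n : ℕ) (c : Config R) : Config R :=
  ⟨c.1, ((R c.1).compFrom c.2.1 x n, c.2.2)⟩

/-- The collection `e` consists of accepting conditions for all undecided elements of `C`. -/
def Commits (C e : Set (Config R)) : Prop :=
  (∀ k q, (⟨k, (q, Tag.star)⟩ : Config R) ∈ C → ∃ p, (⟨k, (q, Tag.circ p)⟩ : Config R) ∈ e) ∧
    ∀ c ∈ e, ∃ k q p, c = ⟨k, (q, Tag.circ p)⟩ ∧ (⟨k, (q, Tag.star)⟩ : Config R) ∈ C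

/-- The runs that meet the objective for `C`, and for which the conditions in `e` are honored from
time `n` on. -/
def commitEvent (ν : S → Set AP) (I : Choice ψ) (C e : Set (Config R)) (n : ℕ) :
    Set (Run S A) :=
  objective ν I C ∩ {ω | ∀ c ∈ e, Wins (advance (labels ν ω) n c) (labels ν (ω.drop n))}

/-- The collection at time `n`, with its undecided elements replaced according to `e`. -/
def committed (ν : S → Set AP) (C e : Set (Config R)) (ω : Run S A) (n : ℕ) : Set (Config R) :=
  {c | c ∈ MDP.trace (drift ν) C ω n ∧ c.2.2 ≠ Tag.star} ∪ advance (labels ν ω) n '' e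

theorem measurableSet_commitEvent [Finite S] [Finite A] (ν : S → Set AP) (I : Choice ψ)
    (C e : Set (Config R)) (n : ℕ) : MeasurableSet (commitEvent (A := A) ν I C e n) := by
  refine (measurableSet_objective ν I C).inter ?_
  have : {ω : Run S A | ∀ c ∈ e, Wins (advance (labels ν ω) n c) (labels ν (ω.drop n))} =
      ⋂ c ∈ e, ⋃ q, {ω | (R c.1).compFrom c.2.1 (labels ν ω) n ∈ ({q} : Set _)} ∩
        {ω | Wins (⟨c.1, (q, c.2.2)⟩ : Config R) (labels ν (ω.drop n))} := by
    ext ω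
    simp [advance]
  rw [this]
  exact MeasurableSet.biInter (Set.toFinite _).countable fun c _ => MeasurableSet.iUnion fun q =>
    (Rabin.measurableSet_compFrom ν _ n _).inter (measurable_drop n (measurableSet_wins ν _))

/-- A ☆ only arises from a ☆, so the undecided elements at time `n` are those of `C` moved by their
automata. This is what makes advancing a commitment made in terms of `C` legal. -/
theorem mem_trace_star_iff (ν : S → Set AP) (C : Set (Config R)) (ω : Run S A) (n : ℕ)
    (k : AutIdx ψ) (q' : (R k).State) :
    (⟨k, (q', Tag.star)⟩ : Config R) ∈ MDP.trace (drift ν) C ω n ↔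
      ∃ q, (⟨k, (q, Tag.star)⟩ : Config R) ∈ C ∧ (R k).compFrom q (labels ν ω) n = q' := by
  induction n generalizing q' with
  | zero => simp [MDP.trace, Rabin.compFrom]
  | succ n ih =>
    constructor
    · rintro ⟨⟨k', q, tag⟩, hc, heq⟩
      have hk : k' = k := congrArg Sigma.fst heq
      subst hk
      have h2 := eq_of_heq (Sigma.mk.inj heq).2
      have htag : tag = Tag.star := (evolveTag_eq_star_iff _ _ _).1 (congrArg Prod.snd h2)
      subst htag
      obtain ⟨q₀, h0, rfl⟩ := (ih q).1 hc
      exact ⟨q₀, h0, congrArg Prod.fst h2⟩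
    · rintro ⟨q, hq, rfl⟩
      exact ⟨_, (ih _).2 ⟨q, hq, rfl⟩, rfl⟩

theorem legal_committed (ν : S → Set AP) (I : Choice ψ) {C e : Set (Config R)} (h : Commits C e)
    (ω : Run S A) (n : ℕ) :
    Legal I (MDP.trace (drift ν) C ω n) (committed ν C e ω n) where
  star k q' hq' := by
    obtain ⟨q, hq, rfl⟩ := (mem_trace_star_iff ν C ω n k q').1 hq'
    obtain ⟨p, hp⟩ := h.1 k q hq
    exact Or.inr ⟨p, Or.inr ⟨_, hp, rfl⟩⟩
  keep k q x hx hc := Or.inl ⟨hc, hx⟩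
  only k q' x hc := by
    rcases hc with hc | ⟨c, hc, heq⟩
    · exact Or.inl hc.1
    · obtain ⟨k', q, p, rfl, hs⟩ := h.2 c hc
      have hk : k' = k := congrArg Sigma.fst heq
      subst hk
      have h2 := eq_of_heq (Sigma.mk.inj heq).2
      refine Or.inr (Or.inl ⟨?_, p, (congrArg Prod.snd h2).symm⟩)
      exact (mem_trace_star_iff ν C ω n _ q').2 ⟨q, hs, congrArg Prod.fst h2⟩

theorem decided_committed (ν : S → Set AP) {C e : Set (Config R)} (h : Commits C e)
    (ω : Run S A) (n : ℕ) : Decided (committed ν C e ω n) := by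
  rintro c (hc | ⟨c, hc, rfl⟩)
  · exact hc.2
  · obtain ⟨k, q, p, rfl, -⟩ := h.2 c hc
    exact fun h' => Tag.noConfusion rfl (heq_of_eq h')

theorem committed_congr (ν : S → Set AP) (C e : Set (Config R)) {ω ω' : Run S A} {n : ℕ}
    (h : ω.hist n = ω'.hist n) : committed ν C e ω n = committed ν C e ω' n := by
  unfold committed
  rw [MDP.trace_congr _ _ h]
  congr 2
  funext c
  simp only [advance, Rabin.compFrom_congr ν _ h]

/-- Honoring persists along the run, so committing later than `n₀` is also sound. The history found
by the zero-one law may be longer than `n₀`. -/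
theorem drop_mem_objective_committed {ν : S → Set AP} {I : Choice ψ} {C e : Set (Config R)}
    (h : Commits C e) {ω : Run S A} {n₀ n : ℕ} (hn : n₀ ≤ n)
    (hω : ω ∈ commitEvent ν I C e n₀) : ω.drop n ∈ objective ν I (committed ν C e ω n) := by
  have h1 := (drop_mem_objective_iff ν I C ω n).2 hω.1
  refine ⟨h1.1, ?_⟩
  rintro c (hc | ⟨c, hc, rfl⟩)
  · exact h1.2 c hc.1
  · have h2 := hω.2 c hc
    obtain ⟨k, q, p, rfl, -⟩ := h.2 c hc
    obtain ⟨m, rfl⟩ := Nat.exists_eq_add_of_le hn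
    have h3 : (R k).Honors ((R k).compFrom q (labels ν ω) n₀) (suffix (labels ν ω) n₀) p.1 := h2
    have h4 := h3.suffix m
    rw [← Rabin.compFrom_add, suffix_suffix] at h4
    exact h4

/-- Every run that meets the objective eventually allows the undecided elements to be committed. -/
theorem exists_mem_commitEvent {ν : S → Set AP} {I : Choice ψ} {C : Set (Config R)}
    {ω : Run S A} (hω : ω ∈ objective ν I C) :
    ∃ e n, Commits C e ∧ ω ∈ commitEvent ν I C e n := by
  -- All conditions met are taken, possibly several for one automaton state, so no selection is
  -- necessary.
  let e : Set (Config R) := {c | ∃ k q p, c = ⟨k, (q, Tag.circ p)⟩ ∧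
    (⟨k, (q, Tag.star)⟩ : Config R) ∈ C ∧ (R k).Meets q (labels ν ω) p.1}
  have hev : ∀ᶠ n in atTop, ∀ c ∈ e, Wins (advance (labels ν ω) n c) (labels ν (ω.drop n)) := by
    refine (eventually_all_finite (Set.toFinite e)).2 ?_
    rintro _ ⟨k, q, p, rfl, -, hp⟩
    exact hp.eventually_honors
  obtain ⟨n, hn⟩ := hev.exists
  refine ⟨e, n, ⟨fun k q hq => ?_, ?_⟩, hω, hn⟩
  · obtain ⟨p, hp, hm⟩ := hω.2 _ hq
    exact ⟨⟨p, hp⟩, k, q, ⟨p, hp⟩, rfl, hq, hm⟩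
  · rintro _ ⟨k, q, p, rfl, hq, -⟩
    exact ⟨k, q, p, rfl, hq⟩

-- The commitment is the only nontrivial choice of collection needed. It is made after a history
-- that nearly guarantees the chosen conditions, and reduces the claim to the decided case.
open Classical in
theorem reaches_of_not_fulfilled [Finite S] [Finite A] {M : MDP S A} {ν : S → Set AP}
    {I : Choice ψ} {T : Set (S × Set (Config R))}
    (hT : ∀ x ∈ secure M ν I, MDP.Reaches (product M ν R I) (secure M ν I)
      {x | Fulfilled x.2} T true x)
    {s : S} {C : Set (Config R)} (hs : (s, C) ∈ secure M ν I) (hF : ¬ Fulfilled C) :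
    MDP.Reaches (product M ν R I) (secure M ν I) {x | Fulfilled x.2} T false (s, C) := by
  by_contra hcon
  let D : Set (S × Set (Config R)) := {x | x ∈ secure M ν I ∧ ¬ Fulfilled x.2 ∧
    ¬ MDP.Reaches (product M ν R I) (secure M ν I) {x | Fulfilled x.2} T false x}
  obtain ⟨σ, h1, h2⟩ := exists_strategy_stays M ν I (D := D)
    (closed_of_not_reaches hT) hs ⟨hs, hF, hcon⟩ (ε := 1 / 8) (by simp)
  have hne := prob_inter_ne_zero σ s ((add_le_add h1 h2).trans_lt
    ((le_self_add.trans_lt (three_eighths_lt_half one_ne_zero ENNReal.one_ne_top)).trans_le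
      ENNReal.half_le_self))
  obtain ⟨e, n₀, he, hZ0⟩ : ∃ e n, Commits C e ∧
      σ.prob s (commitEvent ν I C e n ∩ MDP.stays (drift ν) D C) ≠ 0 := by
    by_contra! hcon
    -- There are countably many pairs (e, n), so one of these events has positive probability.
    refine hne (measure_mono_null (t := ⋃ (e : {e // Commits C e}) (n : ℕ),
      commitEvent ν I C e.1 n ∩ MDP.stays (drift ν) D C) ?_ ?_)
    · rintro ω ⟨hω, hωD⟩
      obtain ⟨e, n, he, hen⟩ := exists_mem_commitEvent hω
      exact Set.mem_iUnion.2 ⟨⟨e, he⟩, Set.mem_iUnion.2 ⟨n, hen, hωD⟩⟩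
    · exact measure_iUnion_null fun e => measure_iUnion_null fun n => hcon e.1 n e.2
  obtain ⟨ε, hε, hε1, hgap⟩ := exists_gap fun x : S × Set (Config R) =>
    M.loss x.1 (objective ν I x.2)
  have hεt : ε ≠ ⊤ := ne_top_of_le_ne_top ENNReal.one_ne_top hε1
  obtain ⟨h, hlen, hZh, hle⟩ := exists_cyl_of_measure_ne_zero (σ.prob s) n₀
    ((measurableSet_commitEvent ν I C e n₀).inter (MDP.measurableSet_stays (drift ν) D C)) hZ0
    (ENNReal.half_pos hε).ne' (ENNReal.half_le_self.trans hε1)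
  obtain ⟨ω, hω, hωZ, hωD⟩ := nonempty_of_measure_ne_zero hZh
  have h0 : σ.prob s (cyl h) ≠ 0 := fun h' => hZh (measure_mono_null Set.inter_subset_left h')
  set n := h.1.length with hn
  have hωh : ω.hist n = h := cyl_hist_eq hω
  have hlast : (ω n).1 = h.2 := congrArg Prod.snd hωh
  have hmem := hωD n
  rw [hlast] at hmem
  have hsec : M.loss h.2 (objective ν I (committed ν C e ω n)) = 0 := by
    refine loss_eq_zero_of_cyl hε hεt σ s h0 (measurableSet_objective ν I _)
      (hgap (h.2, committed ν C e ω n)) ?_ hle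
    rintro ω' hω' ⟨hZ', -⟩
    rw [committed_congr ν C e (hωh.trans (cyl_hist_eq hω').symm)]
    exact drop_mem_objective_committed he hlen hZ'
  obtain ⟨a, ha, hat⟩ := MDP.exists_action_loss_eq_zero (Y' := objective ν I
      (evolveConfig (MDP.trace (drift ν) C ω n) (ν h.2) '' committed ν C e ω n))
    (measurableSet_objective ν I _) (fun a ω h => mem_objective_of_cons ν I _ _ h) hsec
  obtain ⟨t, ht⟩ := M.exists_step_ne_zero h.2 a
  -- The committing step is appended in front of a path from the decided successor; if that
  -- successor is already fulfilled, the bit is set and `T` remains to be reached.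
  refine hmem.2.2 (MDP.Reaches.product_step (legal_committed ν I he ω n) ha hat ht ?_)
  set C' := evolveConfig (MDP.trace (drift ν) C ω n) (ν h.2) '' committed ν C e ω n
  by_cases hF' : Fulfilled C'
  · rw [decide_eq_true (show (t, C') ∈ {x : S × Set (Config R) | Fulfilled x.2} from hF')]
    exact hT _ (hat t ht)
  · rw [decide_eq_false (show (t, C') ∉ {x : S × Set (Config R) | Fulfilled x.2} from hF')]
    exact reaches_of_decided hT (hat t ht) ((decided_committed ν he ω n).image _ _) hF'

/-- A pair in `Υ` for a small tolerance is secure. -/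
theorem loss_le_of_mem_Upsilon [Finite S] [Finite A] {M : MDP S A} {ν : S → Set AP}
    (hR : Represents M ν R) {s_in : S} {σ : M.Strategy} {lam : ℝ} {s : S} {I : Choice ψ}
    {q : (R (mainIdx I)).State} (h : (s, ⟨I, q⟩) ∈ Upsilon ν R s_in σ lam) :
    M.loss s (objective ν I {(⟨mainIdx I, (q, Tag.star)⟩ : Config R)}) ≤ ENNReal.ofReal lam := by
  obtain ⟨g, h0, hs, hq, hp⟩ := h
  simp only at hs hq hp
  subst hs
  set E : Set (Run S A) := {ω | (ψ.resolve I.1).Sat (labels ν ω) ∧ ψ.satFreqs (labels ν ω) = I.1}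
    with hE
  have hEm : MeasurableSet E :=
    (Formula.measurableSet_sat ν _).inter (measurableSet_satFreqs ν I)
  refine MDP.loss_le_of_cyl σ s_in h0 (measurableSet_objective ν I _) ?_
  have h1 : σ.prob s_in (cyl g ∩ {ω | ω.drop g.1.length ∈
      (objective ν I {(⟨mainIdx I, (q, Tag.star)⟩ : Config R)})ᶜ}) ≤ σ.prob s_in (cyl g ∩ Eᶜ) := by
    -- The automata are only known to be correct on actual runs, so the inclusion holds almost
    -- surely.
    refine measure_mono_ae ?_
    filter_upwards [MDP.ae_isRun σ s_in] with ω hrun hω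
    refine ⟨hω.1, fun hωE => hω.2 ⟨?_, ?_⟩⟩
    · exact (ψ.satFreqs_suffix (labels ν ω) g.1.length).trans hωE.2
    · rintro _ rfl
      obtain ⟨p, hp, hm⟩ := ((R _).accepts_iff _).1 ((hR (mainIdx I) ω hrun).2 hωE.1)
      refine ⟨p, hp, ?_⟩
      rw [← (R (mainIdx I)).meets_suffix_iff _ _ g.1.length] at hm
      have hst : (R (mainIdx I)).compFrom (R (mainIdx I)).init (labels ν ω) g.1.length = q := by
        rw [← hq, ← Rabin.foldl_ofFn]
        congr 1
        have : g.1 = ω.pre g.1.length := (mem_cyl.1 hω.1).1.symm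
        conv_rhs => rw [this]
        rw [Run.pre, List.map_ofFn]
        rfl
      rwa [hst] at hm
  refine h1.trans ?_
  have := cond_isProbabilityMeasure (μ := σ.prob s_in) h0
  rw [← cond_mul_eq_inter (measurableSet_cyl g)]
  gcongr
  rw [← ofReal_measureReal, probReal_compl_eq_one_sub hEm]
  exact ENNReal.ofReal_le_ofReal (by linarith)

end Commit

end FreqLTL

/-! ### Choice of the tolerance and conclusion. -/

theorem mainTheorem6 {S A AP : Type*} [Finite S] [Finite A]
    (M : FreqLTL.MDP S A) (ν : S → Set AP) (ψ : FreqLTL.Formula AP)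
    (R : FreqLTL.AutIdx ψ → FreqLTL.Rabin (Set AP)) (hR : FreqLTL.Represents M ν R) :
    ∃ lam₀ : ℝ, 0 < lam₀ ∧ ∀ lam : ℝ, 0 < lam → lam ≤ lam₀ →
      ∀ (s_in : S) (σ : M.Strategy) (s : S) (I : FreqLTL.Choice ψ)
        (q : (R (FreqLTL.mainIdx I)).State),
        (s, ⟨I, q⟩) ∈ FreqLTL.Upsilon ν R s_in σ lam →
        ∃ (T : Set (S × Set (FreqLTL.Config R))) (N : Set (A × Set (FreqLTL.Config R)))
          (π ζ : (FreqLTL.product M ν R I).Strategy),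
          (∀ y ∈ N, FreqLTL.initConfigs R I ⊆ y.2) ∧
          π.Deterministic ∧ π.FiniteMemory ∧ ζ.Deterministic ∧ ζ.FiniteMemory ∧
          (∀ x ∈ T, ∀ ω : FreqLTL.Run (S × Set (FreqLTL.Config R)) (A × Set (FreqLTL.Config R)),
            π.Conforms ω → (ω 0).1 = x → ∀ n, (ω n).1 ∈ T ∧ (ω n).2 ∈ N) ∧
          (∀ x ∈ T ∪ {(s, {⟨FreqLTL.mainIdx I, (q, FreqLTL.Tag.star)⟩})},
            ∀ᵐ ω ∂(ζ.prob x),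
              ∃ i j, i ≤ j ∧ FreqLTL.Fulfilled (ω i).1.2 ∧ (ω j).1 ∈ T) := by
  classical
  -- The gap is taken over all `I` as well, so that the tolerance does not depend on the pair from
  -- Υ.
  obtain ⟨ε, hε, hε1, hgap⟩ := FreqLTL.exists_gap
    fun z : FreqLTL.Choice ψ × S × Set (FreqLTL.Config R) =>
      M.loss z.2.1 (FreqLTL.objective ν z.1 z.2.2)
  have hεt : ε ≠ ⊤ := ne_top_of_le_ne_top ENNReal.one_ne_top hε1
  have hε2 : ε / 2 ≠ ⊤ := ENNReal.div_ne_top hεt (by simp)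
  refine ⟨(ε / 2).toReal, ENNReal.toReal_pos (ENNReal.half_pos hε).ne' hε2, ?_⟩
  intro lam _ hlam s_in σ s I q hΥ
  have hsec : (s, {⟨FreqLTL.mainIdx I, (q, FreqLTL.Tag.star)⟩}) ∈
      FreqLTL.secure (R := R) M ν I := by
    by_contra hne
    refine absurd (ENNReal.half_lt_self hε hεt) (not_lt.2 ((hgap (I, s, _) hne).trans ?_))
    refine (FreqLTL.loss_le_of_mem_Upsilon hR hΥ).trans ?_
    exact ENNReal.ofReal_le_of_le_toReal hlam
  obtain ⟨T, K, hTsec, hTK, hTN⟩ := FreqLTL.exists_closed_set (R := R) M ν I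
  have hreach : ∀ x ∈ FreqLTL.secure (R := R) M ν I, FreqLTL.MDP.Reaches (FreqLTL.product M ν R I)
      (FreqLTL.secure M ν I) {x | FreqLTL.Fulfilled x.2} T true x :=
    fun x hx => FreqLTL.reaches_of_flag hR I hTK hx
  -- Any product state will do: it only fills the initial memory.
  let x₀ : S × Set (FreqLTL.Config R) := (s, ∅)
  obtain ⟨π, hπ, hπ', hπT⟩ := FreqLTL.MDP.exists_strategy_of_closed
    (FreqLTL.product M ν R I) x₀ T _ hTN
  obtain ⟨ζ, hζ, hζ', hζT⟩ := FreqLTL.MDP.exists_strategy_of_reaches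
    (FreqLTL.product M ν R I) x₀ (FreqLTL.secure M ν I) {x | FreqLTL.Fulfilled x.2} T (by
      rintro b ⟨t, C⟩ hx
      by_cases hb : (b || decide ((t, C) ∈ {x : S × Set (FreqLTL.Config R) |
          FreqLTL.Fulfilled x.2})) = true
      · rw [hb]
        exact hreach _ hx
      · rw [Bool.not_eq_true] at hb
        rw [hb]
        simp only [Bool.or_eq_false_iff, decide_eq_false_iff_not] at hb
        exact FreqLTL.reaches_of_not_fulfilled hreach hx hb.2)
  refine ⟨T, _, π, ζ, fun y hy => hy, hπ, hπ', hζ, hζ', ?_, ?_⟩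
  · rintro x hx ω hω rfl
    exact hπT ω hω hx
  · rintro x (hx | rfl)
    · exact hζT x (hTsec hx)
    · exact hζT _ hsec
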